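/- Let $\mathbb D$ be the open unit disc, $\mathbb T$ the unit circle, and $m,n\ge 1$. Let $\phi=\tilde p/p$ be a rational inner function on $\mathbb D^2$ of bidegree $(m,n)$: here $p\in\mathbb C[z_1,z_2]$ has degree at most $m$ in $z_1$ and at most $n$ in $z_2$, has no zeros in $\mathbb D^2$, and has no common factor with its reflection $\tilde p(z_1,z_2)=z_1^m z_2^n\,\overline{p(1/\bar z_1,1/\bar z_2)}$. Let $\alpha\in\mathbb T$ be a generic value for $\phi$, i.e. there is no $\tau\in\mathbb T$ such that $\phi(\tau,\cdot)\equiv\alpha$ on $\mathbb D$ or $\phi(\cdot,\tau)\equiv\alpha$ on $\mathbb D$. Let $C_w(z)=\prod_{j=1}^2 (1-z_j\overline{w_j})^{-1}$, let $H^2(\mathbb D^2)$ be the Hardy space of functions $f(z)=\sum_{j,k\ge 0}a_{jk}z_1^jz_2^k$ on $\mathbb D^2$ with $\|f\|^2=\sum|a_{jk}|^2<\infty$, and let $K_\phi=H^2(\mathbb D^2)\ominus\phi H^2(\mathbb D^2)$, whose reproducing kernels are $K_w(z)=(1-\overline{\phi(w)}\phi(z))C_w(z)$, $w\in\mathbb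 D^2$. Then there is a unique finite positive Borel measure $\sigma_\alpha$ on $\mathbb T^2$ (the Clark measure) with $$\frac{1-|\phi(z)|^2}{|\alpha-\phi(z)|^2}=\int_{\mathbb T^2}\prod_{j=1}^2\frac{1-|z_j|^2}{|\zeta_j-z_j|^2}\,d\sigma_\alpha(\zeta)\qquad(z\in\mathbb D^2),$$ there is a unique bounded linear operator $J_\alpha:K_\phi\to L^2(\sigma_\alpha)$ (the Clark embedding) with $$(J_\alpha K_w)(\zeta)=(1-\alpha\overline{\phi(w)})\,C_w(\zeta)\quad\text{for }\sigma_\alpha\text{-a.e. }\zeta\in\mathbb T^2,\text{ for all }w\in\mathbb D^2,$$ and $J_\alpha$ is unitary, i.e. a surjective linear isometry. -/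

import Mathlib

open MeasureTheory
open scoped ComplexConjugate InnerProductSpace

noncomputable section

instance : MeasurableSpace Circle := borel Circle

instance : BorelSpace Circle := ⟨rfl⟩

/-- The open unit bidisk `𝔻²`. -/
def bidisk : Set (Fin 2 → ℂ) := {z | ∀ j, ‖z j‖ < 1}

/-- The Cauchy (Szegő) kernel of the bidisk, `C_w(z) = ∏ⱼ 1 / (1 - zⱼ conj wⱼ)`. -/
def cauchyKernel (w z : Fin 2 → ℂ) : ℂ := ∏ j, 1 / (1 - z j * conj (w j))

/-- The Poisson kernel of the bidisk, `P_z(ζ) = ∏ⱼ (1 - |zⱼ|²) / |ζⱼ - zⱼ|²`. -/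
def poissonKernelBidisk (z : Fin 2 → ℂ) (ζ : Fin 2 → Circle) : ℝ :=
  ∏ j, (1 - ‖z j‖ ^ 2) / ‖(ζ j : ℂ) - z j‖ ^ 2

/-! ### Rational inner functions -/

/-- The reflection `p̃(z) = z₁ᵐ z₂ⁿ conj (p (1 / conj z₁, 1 / conj z₂))` of a polynomial `p` whose
degrees in the two variables are at most `m` and `n`. -/
def reflectPoly (m n : ℕ) (p : MvPolynomial (Fin 2) ℂ) : MvPolynomial (Fin 2) ℂ :=
  ∑ k ∈ p.support, MvPolynomial.C (conj (p.coeff k)) *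
    MvPolynomial.X 0 ^ (m - k 0) * MvPolynomial.X 1 ^ (n - k 1)

/-- The values of `p̃` off the coordinate axes. -/
theorem eval_reflectPoly (m n : ℕ) (p : MvPolynomial (Fin 2) ℂ) (h0 : p.degreeOf 0 ≤ m)
    (h1 : p.degreeOf 1 ≤ n) (z : Fin 2 → ℂ) (hz : ∀ j, z j ≠ 0) :
    MvPolynomial.eval z (reflectPoly m n p) =
      z 0 ^ m * z 1 ^ n * conj (MvPolynomial.eval (fun j => 1 / conj (z j)) p) := by
  rw [MvPolynomial.eval_eq (fun j => 1 / conj (z j)), reflectPoly, map_sum, map_sum, Finset.mul_sum]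
  refine Finset.sum_congr rfl fun k hk => ?_
  have a0 : k 0 ≤ m := (MvPolynomial.le_degreeOf_of_mem_support 0 hk).trans h0
  have a1 : k 1 ≤ n := (MvPolynomial.le_degreeOf_of_mem_support 1 hk).trans h1
  obtain ⟨a, ha⟩ := Nat.exists_eq_add_of_le a0
  obtain ⟨b, hb⟩ := Nat.exists_eq_add_of_le a1
  have e0 : z 0 ^ k 0 ≠ 0 := pow_ne_zero _ (hz 0)
  have e1 : z 1 ^ k 1 ≠ 0 := pow_ne_zero _ (hz 1)
  have hs : ∏ i ∈ k.support, (1 / conj (z i)) ^ k i = ∏ i, (1 / conj (z i)) ^ k i :=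
    Finset.prod_subset (Finset.subset_univ _) fun i _ hi => by
      rw [Finsupp.notMem_support_iff.1 hi, pow_zero]
  rw [hs, ha, hb]
  simp only [Fin.prod_univ_two, map_mul, map_pow, map_div₀, map_one, Complex.conj_conj,
    MvPolynomial.eval_C, MvPolynomial.eval_X, Nat.add_sub_cancel_left, pow_add, div_pow, one_pow]
  field_simp

/-- `p` is the denominator of a rational inner function `p̃ / p` of bidegree `(m, n)`:
`p` has degrees at most `m` and `n` in the two variables, is stable (no zeros in `𝔻²`) and has
no factor in common with its reflection `p̃`. As `p(0) ≠ 0`, the degrees of `p̃` are exactly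
`m` and `n`, so `(m, n)` is the bidegree of `p̃ / p`. -/
structure IsRIFDenominator (m n : ℕ) (p : MvPolynomial (Fin 2) ℂ) : Prop where
  degreeOf_zero_le : p.degreeOf 0 ≤ m
  degreeOf_one_le : p.degreeOf 1 ≤ n
  stable : ∀ z ∈ bidisk, MvPolynomial.eval z p ≠ 0
  isRelPrime : IsRelPrime p (reflectPoly m n p)

/-- The rational function `φ = p̃ / p`. -/
def rif (m n : ℕ) (p : MvPolynomial (Fin 2) ℂ) (z : Fin 2 → ℂ) : ℂ :=
  MvPolynomial.eval z (reflectPoly m n p) / MvPolynomial.eval z p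

/-- `α ∈ 𝕋` is exceptional for `φ` if `φ(τ, ·) ≡ α` or `φ(·, τ) ≡ α` on `𝔻` for some `τ ∈ 𝕋`. -/
def IsExceptionalValue (φ : (Fin 2 → ℂ) → ℂ) (α : Circle) : Prop :=
  ∃ τ : Circle, (∀ z : ℂ, ‖z‖ < 1 → φ ![(τ : ℂ), z] = α) ∨
    (∀ z : ℂ, ‖z‖ < 1 → φ ![z, (τ : ℂ)] = α)

/-- `α ∈ 𝕋` is generic for `φ` if it is not exceptional. -/
def IsGenericValue (φ : (Fin 2 → ℂ) → ℂ) (α : Circle) : Prop :=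
  ¬ IsExceptionalValue φ α

/-! ### Clark measures -/

/-- `σ` is the Clark measure of `φ` at `α`: a finite positive Borel measure on `𝕋²` whose
Poisson integral is `(1 - |φ|²) / |α - φ|²`. -/
structure IsClarkMeasure (φ : (Fin 2 → ℂ) → ℂ) (α : Circle)
    (σ : Measure (Fin 2 → Circle)) : Prop where
  isFiniteMeasure : IsFiniteMeasure σ
  poisson_eq : ∀ z ∈ bidisk,
    (1 - ‖φ z‖ ^ 2) / ‖(α : ℂ) - φ z‖ ^ 2 = ∫ ζ, poissonKernelBidisk z ζ ∂σ

/-! ### The Hardy space and the model space -/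

/-- The Hardy space `H²(𝔻²)`: the functions `f(z) = ∑ a_{jk} z₁ʲ z₂ᵏ` on `𝔻²` with square summable
Taylor coefficients, with the norm `(∑ |a_{jk}|²)^(1/2)`; an element is stored as its family of
coefficients, and `hardyEval` gives the function on `𝔻²`. -/
abbrev HardyBidisk : Type := lp (fun _ : ℕ × ℕ => ℂ) 2

/-- The value at `z ∈ 𝔻²` of a function in the Hardy space. -/
def hardyEval (f : HardyBidisk) (z : Fin 2 → ℂ) : ℂ := ∑' k : ℕ × ℕ, f k * (z 0 ^ k.1 * z 1 ^ k.2)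

theorem summable_hardyEval (f : HardyBidisk) {z : Fin 2 → ℂ} (hz : z ∈ bidisk) :
    Summable fun k : ℕ × ℕ => f k * (z 0 ^ k.1 * z 1 ^ k.2) := by
  have hgeom : ∀ j, Summable fun i : ℕ => (‖z j‖ ^ 2) ^ i := fun j =>
    summable_geometric_of_lt_one (by positivity)
      (by have := hz j; have := norm_nonneg (z j); nlinarith)
  have hpow : Summable fun k : ℕ × ℕ => ‖z 0 ^ k.1 * z 1 ^ k.2‖ ^ 2 := by
    refine ((hgeom 0).mul_of_nonneg (hgeom 1) (fun i => by positivity)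
      (fun i => by positivity)).congr fun k => ?_
    rw [norm_mul, norm_pow, norm_pow]
    ring
  have hf : Summable fun k : ℕ × ℕ => ‖f k‖ ^ 2 := by
    simpa using (memℓp_gen_iff (by norm_num)).1 (lp.memℓp f)
  refine Summable.of_norm_bounded (hf.add hpow) fun k => ?_
  rw [norm_mul]
  nlinarith [sq_nonneg (‖f k‖ - ‖z 0 ^ k.1 * z 1 ^ k.2‖), norm_nonneg (f k),
    norm_nonneg (z 0 ^ k.1 * z 1 ^ k.2), sq_nonneg (‖f k‖), sq_nonneg ‖z 0 ^ k.1 * z 1 ^ k.2‖]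

/-- The subspace `φ H²(𝔻²)` of `H²(𝔻²)`. -/
def multiplierRange (φ : (Fin 2 → ℂ) → ℂ) : Submodule ℂ HardyBidisk where
  carrier := {f | ∃ g : HardyBidisk, ∀ z ∈ bidisk, hardyEval f z = φ z * hardyEval g z}
  zero_mem' := ⟨0, fun z _ => by simp [hardyEval]⟩
  add_mem' := by
    rintro f₁ f₂ ⟨g₁, h₁⟩ ⟨g₂, h₂⟩
    refine ⟨g₁ + g₂, fun z hz => ?_⟩
    have key : ∀ u v : HardyBidisk, hardyEval (u + v) z = hardyEval u z + hardyEval v z := by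
      intro u v
      simp only [hardyEval]
      rw [← (summable_hardyEval u hz).tsum_add (summable_hardyEval v hz)]
      exact tsum_congr fun k => by simp [add_mul]
    rw [key, key, h₁ z hz, h₂ z hz, mul_add]
  smul_mem' := by
    rintro c f ⟨g, h⟩
    refine ⟨c • g, fun z hz => ?_⟩
    have key : ∀ u : HardyBidisk, hardyEval (c • u) z = c * hardyEval u z := by
      intro u
      simp only [hardyEval]
      rw [← tsum_mul_left]
      exact tsum_congr fun k => by simp [mul_assoc]
    rw [key, key, h z hz]
    ring

/-- The model space `K_φ = H²(𝔻²) ⊖ φ H²(𝔻²)`. -/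
def modelSpace (φ : (Fin 2 → ℂ) → ℂ) : Submodule ℂ HardyBidisk := (multiplierRange φ)ᗮ

/-! ### Clark embeddings -/

/-- `T : K_φ → L²(σ)` takes the reproducing kernel `K_w(z) = (1 - conj φ(w) φ(z)) C_w(z)` of `K_φ`
to the function `ζ ↦ (1 - α conj φ(w)) C_w(ζ)`, for every `w ∈ 𝔻²`. -/
def IsClarkEmbedding (φ : (Fin 2 → ℂ) → ℂ) (α : Circle) (σ : Measure (Fin 2 → Circle))
    (T : modelSpace φ →L[ℂ] Lp ℂ 2 σ) : Prop :=
  ∀ w ∈ bidisk, ∃ k : modelSpace φ,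
    (∀ z ∈ bidisk, hardyEval k z = (1 - conj (φ w) * φ z) * cauchyKernel w z) ∧
    (T k : (Fin 2 → Circle) → ℂ) =ᵐ[σ]
      fun ζ => (1 - (α : ℂ) * conj (φ w)) * cauchyKernel w (fun j => (ζ j : ℂ))

end

/-!
Let `A ⊆ C(𝕋²)` be the bidisc algebra, the uniform closure of the polynomials. By Gelfand theory a
polynomial without zeros on the closed bidisc is invertible in `A` (`exists_mul_polyMap_eq_one`),
and the Cauchy kernels span a dense subspace of `A` (`bidiscAlgebra_le_of_cauchyTorus_mem`).
Functions in `A` are reproduced inside the bidisc by the Cauchy kernel, multiplicatively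
(`cauchyEval_mul`). A polynomial of degree `d` without zeros in the bidisc satisfies
`|q(ζ)| ≤ 2 ^ d |q(r ζ)|` on the torus (`norm_eval_le_radial`). These facts carry the four parts of
the argument.

*The model space.* As `p(z) / p(r z)` is bounded on the torus and converges to `1` in the bidisc,
`p` is cyclic in the Hardy space. Since `|p̃| = |p|` on the torus, the map `p a ↦ p̃ a` extends to
an isometry, which is multiplication by `φ` (`IsRIFDenominator.exists_isometry`). This gives the
reproducing kernels of the model space, and `|φ| < 1` in the bidisc.

*Uniqueness of the measure.* Integrating the Poisson integral of a measure, restricted to the torus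
of radius `1 / 2`, against a character gives a nonzero multiple of a Fourier coefficient
(`measure_ext_of_integral_poissonKernel`).

*Existence of the measure.* The Clark measure is a weak limit of the densities `Re h(r ζ)`, where
`h = (α + φ) / (α - φ)` and `ζ ↦ h(r ζ)` is in `A`. The limit inherits the polarized identity for
`∫ conj C_z C_w dσ`, which says that the functions `(1 - α conj φ(w)) C_w` have in `L²(σ)` the same
Gram matrix as the kernels `K_w`. With `q = p̃ - α p`, the density `Re h(r ζ)` is
`(|p(r ζ)|² - |p̃(r ζ)|²) / |q(r ζ)|²`, so by the radial inequality `∫ |q|² dσ = 0`: the Clark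
measure is carried by the zeros of `q` (`IsRIFDenominator.exists_clarkMeasure`).

*Surjectivity.* Write `q = q₀ + zⱼ s` with `q₀` independent of `zⱼ`. For generic `α` the polynomial
`q₀` has no zeros on the closed bidisc, since a zero with a unimodular coordinate `τ` would, by a
Harnack inequality, force `φ = α` on a disc. So `conj ζⱼ = - s / q₀` almost everywhere for `σ`, with
`s / q₀` in `A` (`IsRIFDenominator.exists_mem_bidiscAlgebra_eq_conj`). Hence the closure of `A` in
`L²(σ)` contains all characters of the torus, and by the Stone–Weierstrass theorem it is everything.
-/

open Filter Topology

noncomputable section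

/-! ### Fourier analysis on the torus -/

instance : SecondCountableTopology Circle :=
  inferInstanceAs (SecondCountableTopology (Metric.sphere (0 : ℂ) 1))

/-- The normalized Haar measure of the torus `𝕋²`. -/
def torusHaar : Measure (Fin 2 → Circle) := Measure.pi fun _ => Measure.haarMeasure ⊤

instance : IsProbabilityMeasure
    (Measure.haarMeasure (⊤ : TopologicalSpace.PositiveCompacts Circle)) :=
  ⟨Measure.haarMeasure_self⟩

instance : IsProbabilityMeasure torusHaar := by unfold torusHaar; infer_instance

instance : torusHaar.IsHaarMeasure := by unfold torusHaar; infer_instance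

theorem integrable_continuousMap (μ : Measure (Fin 2 → Circle)) [IsFiniteMeasure μ]
    (f : C(Fin 2 → Circle, ℂ)) : Integrable f μ :=
  Integrable.of_bound f.continuous.aestronglyMeasurable ‖f‖ (ae_of_all _ f.norm_coe_le_norm)

/-- Integration against a finite measure, as a functional on `C(𝕋²)`. -/
def integralCM (μ : Measure (Fin 2 → Circle)) [IsFiniteMeasure μ] :
    C(Fin 2 → Circle, ℂ) →L[ℂ] ℂ :=
  LinearMap.mkContinuous
    { toFun := fun f => ∫ ζ, f ζ ∂μ
      map_add' := fun f g => integral_add (integrable_continuousMap μ f)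
        (integrable_continuousMap μ g)
      map_smul' := fun c f => integral_smul c _ }
    (μ.real Set.univ) fun f => by
      rw [mul_comm]
      exact norm_integral_le_of_norm_le_const (ae_of_all _ f.norm_coe_le_norm)

theorem integralCM_apply (μ : Measure (Fin 2 → Circle)) [IsFiniteMeasure μ]
    (f : C(Fin 2 → Circle, ℂ)) : integralCM μ f = ∫ ζ, f ζ ∂μ := rfl

/-- The character `ζ ↦ ζ₀ ^ k₀ * ζ₁ ^ k₁` of the torus. -/
def torusChar (k : Fin 2 → ℤ) : C(Fin 2 → Circle, ℂ) where
  toFun ζ := ∏ j, ((ζ j ^ k j : Circle) : ℂ)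
  continuous_toFun := continuous_finsetProd _ fun j _ =>
    (by fun_prop : Continuous ((↑) : Circle → ℂ)).comp ((continuous_apply j).zpow (k j))

theorem torusChar_apply (k : Fin 2 → ℤ) (ζ : Fin 2 → Circle) :
    torusChar k ζ = ∏ j, ((ζ j ^ k j : Circle) : ℂ) := rfl

theorem torusChar_add (k l : Fin 2 → ℤ) : torusChar (k + l) = torusChar k * torusChar l := by
  ext ζ
  simp [torusChar_apply, zpow_add]
  ring

theorem torusChar_zero : torusChar 0 = 1 := by
  ext ζ
  simp [torusChar_apply]

theorem torusChar_neg (k : Fin 2 → ℤ) : torusChar (-k) = star (torusChar k) := by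
  ext ζ
  simp [torusChar_apply, Circle.coe_inv_eq_conj, -Circle.coe_zpow, -Circle.coe_inv]

theorem torusChar_apply_mul (k : Fin 2 → ℤ) (ζ η : Fin 2 → Circle) :
    torusChar k (ζ * η) = torusChar k ζ * torusChar k η := by
  simp [torusChar_apply, mul_zpow]
  ring

theorem norm_torusChar_apply (k : Fin 2 → ℤ) (ζ : Fin 2 → Circle) : ‖torusChar k ζ‖ = 1 := by
  rw [torusChar_apply, norm_prod]
  exact Finset.prod_eq_one fun j _ => Circle.norm_coe _

theorem torusChar_single (j : Fin 2) (ζ : Fin 2 → Circle) :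
    torusChar (Pi.single j 1) ζ = ζ j := by
  rw [torusChar_apply, Finset.prod_eq_single j]
  · simp
  · intro i _ hi
    simp [Pi.single_eq_of_ne hi]
  · simp

theorem integral_torusChar_of_ne_zero {k : Fin 2 → ℤ} (hk : k ≠ 0) :
    ∫ ζ, torusChar k ζ ∂torusHaar = 0 := by
  obtain ⟨i, hi⟩ : ∃ i, k i ≠ 0 := by
    by_contra! h
    exact hk (funext h)
  -- translate by an element at which the character is `-1`
  obtain ⟨η, hη⟩ : ∃ η : Fin 2 → Circle, torusChar k η = -1 := by
    refine ⟨Pi.mulSingle i (Circle.exp (Real.pi / k i)), ?_⟩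
    rw [torusChar_apply, Finset.prod_eq_single i]
    · have : (k i : ℝ) ≠ 0 := by exact_mod_cast hi
      rw [Pi.mulSingle_eq_same, ← Circle.exp_zsmul, zsmul_eq_mul, mul_div_cancel₀ _ this]
      simp
    · intro j _ hj
      simp [Pi.mulSingle_eq_of_ne hj]
    · simp
  have h := integral_mul_left_eq_self (μ := torusHaar) (fun ζ => torusChar k ζ) η
  simp only [torusChar_apply_mul, hη, neg_one_mul, integral_neg] at h
  exact self_eq_neg.1 h.symm

theorem integral_torusChar_zero : ∫ ζ, torusChar 0 ζ ∂torusHaar = 1 := by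
  simp [torusChar_zero]

theorem span_torusChar_topologicalClosure :
    (Submodule.span ℂ (Set.range torusChar)).topologicalClosure = ⊤ := by
  let S : StarSubalgebra ℂ C(Fin 2 → Circle, ℂ) :=
    { Algebra.adjoin ℂ (Set.range torusChar) with
      star_mem' := by
        change Algebra.adjoin ℂ (Set.range torusChar) ≤
          star (Algebra.adjoin ℂ (Set.range torusChar))
        refine Algebra.adjoin_le ?_
        rintro - ⟨k, rfl⟩
        exact Algebra.subset_adjoin ⟨-k, torusChar_neg k⟩ }
  have hS : Subalgebra.toSubmodule S.toSubalgebra = Submodule.span ℂ (Set.range torusChar) := by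
    apply Algebra.adjoin_eq_span_of_subset
    refine .trans (fun x => ?_) Submodule.subset_span
    intro hx
    induction hx using Submonoid.closure_induction with
    | mem _ hx => exact hx
    | one => exact ⟨0, torusChar_zero⟩
    | mul x y _ _ hx hy =>
      obtain ⟨⟨k, rfl⟩, l, rfl⟩ := And.intro hx hy
      exact ⟨k + l, torusChar_add k l⟩
  have hsep : S.toSubalgebra.SeparatesPoints := by
    intro ζ η h
    obtain ⟨j, hj⟩ : ∃ j, ζ j ≠ η j := by
      by_contra! h'
      exact h (funext h')
    refine ⟨_, ⟨torusChar (Pi.single j 1), Algebra.subset_adjoin ⟨_, rfl⟩, rfl⟩, ?_⟩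
    beta_reduce
    rw [torusChar_single, torusChar_single]
    exact fun h => hj (Circle.ext h)
  rw [← hS]
  exact congrArg (Subalgebra.toSubmodule <| StarSubalgebra.toSubalgebra ·)
    (ContinuousMap.starSubalgebra_topologicalClosure_eq_top_of_separatesPoints S hsep)

/-- A closed subspace of `C(𝕋²)` that contains the characters is everything. -/
theorem mem_of_forall_torusChar_mem {S : Submodule ℂ C(Fin 2 → Circle, ℂ)}
    (hS : IsClosed (S : Set C(Fin 2 → Circle, ℂ))) (h : ∀ k, torusChar k ∈ S)
    (f : C(Fin 2 → Circle, ℂ)) : f ∈ S := by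
  have htop : (⊤ : Submodule ℂ C(Fin 2 → Circle, ℂ)) ≤ S := by
    rw [← span_torusChar_topologicalClosure]
    refine Submodule.topologicalClosure_minimal _ (Submodule.span_le.2 ?_) hS
    rintro - ⟨k, rfl⟩
    exact h k
  exact htop Submodule.mem_top

/-- A finite measure on the torus is determined by its Fourier coefficients. -/
theorem measure_ext_of_integral_torusChar {μ ν : Measure (Fin 2 → Circle)} [IsFiniteMeasure μ]
    [IsFiniteMeasure ν] (h : ∀ k, ∫ ζ, torusChar k ζ ∂μ = ∫ ζ, torusChar k ζ ∂ν) : μ = ν := by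
  refine ext_of_forall_integral_eq_of_IsFiniteMeasure fun f => ?_
  let F : C(Fin 2 → Circle, ℂ) := ⟨fun ζ => (f ζ : ℂ), by fun_prop⟩
  have hF : F ∈ LinearMap.eqLocus (integralCM μ).toLinearMap (integralCM ν).toLinearMap :=
    mem_of_forall_torusChar_mem
      (isClosed_eq (integralCM μ).continuous (integralCM ν).continuous) h F
  have hF' : ∫ ζ, F ζ ∂μ = ∫ ζ, F ζ ∂ν := hF
  simp only [F, ContinuousMap.coe_mk, integral_complex_ofReal] at hF'
  exact_mod_cast hF'

/-! ### The bidisc algebra -/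

/-- A polynomial in two variables as a function on the torus. -/
def polyMap : MvPolynomial (Fin 2) ℂ →ₐ[ℂ] C(Fin 2 → Circle, ℂ) :=
  MvPolynomial.aeval fun j => torusChar (Pi.single j 1)

theorem polyMap_apply (P : MvPolynomial (Fin 2) ℂ) (ζ : Fin 2 → Circle) :
    polyMap P ζ = MvPolynomial.eval (fun j => (ζ j : ℂ)) P := by
  induction P using MvPolynomial.induction_on with
  | C c => simp [polyMap]
  | add p q hp hq => simp [hp, hq]
  | mul_X p j hp =>
    rw [map_mul, ContinuousMap.mul_apply, hp, map_mul, MvPolynomial.eval_X, polyMap,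
      MvPolynomial.aeval_X, torusChar_single]

/-- The bidisc algebra: the uniform closure of the polynomials in `C(𝕋²)`. -/
def bidiscAlgebra : Subalgebra ℂ C(Fin 2 → Circle, ℂ) := polyMap.range.topologicalClosure

theorem polyMap_mem (P : MvPolynomial (Fin 2) ℂ) : polyMap P ∈ bidiscAlgebra :=
  polyMap.range.le_topologicalClosure ⟨P, rfl⟩

theorem isClosed_bidiscAlgebra : IsClosed (bidiscAlgebra : Set C(Fin 2 → Circle, ℂ)) :=
  polyMap.range.isClosed_topologicalClosure

theorem bidiscAlgebra_induction {s : Set C(Fin 2 → Circle, ℂ)} (hs : IsClosed s)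
    (h : ∀ P, polyMap P ∈ s) {a : C(Fin 2 → Circle, ℂ)} (ha : a ∈ bidiscAlgebra) : a ∈ s := by
  have ha' : a ∈ closure (Set.range polyMap) := ha
  exact closure_minimal (Set.range_subset_iff.2 h) hs ha'

/-- A pair of natural numbers as the index of a character of `𝕋²`. -/
def natIndex (k : ℕ × ℕ) : Fin 2 → ℤ := ![(k.1 : ℤ), (k.2 : ℤ)]

theorem natIndex_injective : Function.Injective natIndex := by
  intro k l h
  have h0 := congrFun h 0
  have h1 := congrFun h 1
  simp only [natIndex, Matrix.cons_val_zero, Matrix.cons_val_one, Nat.cast_inj] at h0 h1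
  exact Prod.ext h0 h1

theorem torusChar_natIndex (k : ℕ × ℕ) : torusChar (natIndex k) =
    torusChar (Pi.single 0 1) ^ k.1 * torusChar (Pi.single 1 1) ^ k.2 := by
  ext ζ
  rw [ContinuousMap.mul_apply, ContinuousMap.pow_apply, ContinuousMap.pow_apply, torusChar_single,
    torusChar_single, torusChar_apply, Fin.prod_univ_two]
  simp [natIndex]

theorem polyMap_monomial (u : Fin 2 →₀ ℕ) (c : ℂ) :
    polyMap (MvPolynomial.monomial u c) = c • torusChar (natIndex (u 0, u 1)) := by
  rw [polyMap, MvPolynomial.aeval_monomial, Finsupp.prod_fintype _ _ (by simp), Fin.prod_univ_two,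
    torusChar_natIndex, Algebra.smul_def]

theorem torusChar_natIndex_mem (k : ℕ × ℕ) : torusChar (natIndex k) ∈ bidiscAlgebra := by
  rw [torusChar_natIndex]
  refine mul_mem (pow_mem ?_ _) (pow_mem ?_ _) <;>
  · convert polyMap_mem (MvPolynomial.X _)
    simp only [polyMap, MvPolynomial.aeval_X]
    rfl

theorem polyMap_induction {S : Submodule ℂ C(Fin 2 → Circle, ℂ)}
    (h : ∀ k, torusChar (natIndex k) ∈ S) (P : MvPolynomial (Fin 2) ℂ) : polyMap P ∈ S := by
  induction P using MvPolynomial.induction_on' with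
  | monomial u c =>
    rw [polyMap_monomial]
    exact S.smul_mem _ (h _)
  | add p q hp hq =>
    rw [map_add]
    exact S.add_mem hp hq

/-! ### The Cauchy kernel and the Hardy space -/

theorem one_sub_mul_conj_ne_zero {a b : ℂ} (ha : ‖a‖ ≤ 1) (hb : ‖b‖ < 1) : 1 - a * conj b ≠ 0 := by
  intro h
  have h1 : ‖a * conj b‖ = 1 := by rw [← sub_eq_zero.1 h, norm_one]
  rw [norm_mul, RCLike.norm_conj] at h1
  nlinarith [norm_nonneg a, norm_nonneg b]

/-- The Cauchy kernel as a continuous function on the torus. -/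
def cauchyTorus (w : bidisk) : C(Fin 2 → Circle, ℂ) where
  toFun ζ := cauchyKernel w fun j => (ζ j : ℂ)
  continuous_toFun := by
    refine continuous_finsetProd _ fun j _ => ?_
    refine Continuous.div continuous_const (by fun_prop) fun ζ => ?_
    exact one_sub_mul_conj_ne_zero (Circle.norm_coe _).le (w.2 j)

theorem cauchyTorus_apply (w : bidisk) (ζ : Fin 2 → Circle) :
    cauchyTorus w ζ = cauchyKernel w fun j => (ζ j : ℂ) := rfl

theorem summable_norm_pow (w : bidisk) :
    Summable fun k : ℕ × ℕ => ‖w.1 0‖ ^ k.1 * ‖w.1 1‖ ^ k.2 :=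
  (summable_geometric_of_lt_one (norm_nonneg _) (w.2 0)).mul_of_nonneg
    (summable_geometric_of_lt_one (norm_nonneg _) (w.2 1))
    (fun _ => by positivity) (fun _ => by positivity)

theorem hasSum_cauchyKernel (w : bidisk) (z : Fin 2 → ℂ) (hz : ∀ j, ‖z j‖ ≤ 1) :
    HasSum (fun k : ℕ × ℕ => conj (w.1 0 ^ k.1 * w.1 1 ^ k.2) * (z 0 ^ k.1 * z 1 ^ k.2))
      (cauchyKernel w z) := by
  have hlt : ∀ j, ‖z j * conj (w.1 j)‖ < 1 := fun j => by
    rw [norm_mul, RCLike.norm_conj]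
    nlinarith [norm_nonneg (z j), norm_nonneg (w.1 j), w.2 j, hz j]
  have h := (hasSum_geometric_of_norm_lt_one (hlt 0)).mul
    (hasSum_geometric_of_norm_lt_one (hlt 1))
    (summable_mul_of_summable_norm
      (by simpa using! summable_geometric_of_lt_one (norm_nonneg _) (hlt 0))
      (by simpa using! summable_geometric_of_lt_one (norm_nonneg _) (hlt 1)))
  rw [cauchyKernel, Fin.prod_univ_two, one_div, one_div]
  refine h.congr_fun fun k => ?_
  simp only [map_mul, map_pow, mul_pow]
  ring

/-- The expansion of the Cauchy kernel converges uniformly on the torus. -/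
theorem hasSum_cauchyTorus (w : bidisk) :
    HasSum (fun k : ℕ × ℕ => conj (w.1 0 ^ k.1 * w.1 1 ^ k.2) • torusChar (natIndex k))
      (cauchyTorus w) := by
  have hs : Summable fun k : ℕ × ℕ =>
      conj (w.1 0 ^ k.1 * w.1 1 ^ k.2) • torusChar (natIndex k) := by
    refine Summable.of_norm_bounded (summable_norm_pow w) fun k => ?_
    refine (ContinuousMap.norm_le _ (by positivity)).2 fun ζ => ?_
    rw [ContinuousMap.smul_apply, norm_smul, norm_torusChar_apply, RCLike.norm_conj]
    simp
  convert hs.hasSum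
  ext ζ
  have h1 := ContinuousMap.hasSum_apply hs.hasSum ζ
  refine (hasSum_cauchyKernel w (fun j => (ζ j : ℂ)) fun j => (Circle.norm_coe _).le).unique ?_
  convert h1 using 2 with k
  rw [ContinuousMap.smul_apply, torusChar_natIndex, ContinuousMap.mul_apply,
    ContinuousMap.pow_apply, ContinuousMap.pow_apply, torusChar_single, torusChar_single,
    smul_eq_mul]

theorem cauchyTorus_mem (w : bidisk) : cauchyTorus w ∈ bidiscAlgebra :=
  isClosed_bidiscAlgebra.mem_of_tendsto (hasSum_cauchyTorus w) <| Eventually.of_forall fun _ =>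
    sum_mem fun k _ => bidiscAlgebra.smul_mem (torusChar_natIndex_mem k) _

/-- Continuous functions on the torus as elements of `L²(μ)`. -/
abbrev torusToL2 (μ : Measure (Fin 2 → Circle)) [IsFiniteMeasure μ] :
    C(Fin 2 → Circle, ℂ) →L[ℂ] Lp ℂ 2 μ := ContinuousMap.toLp 2 μ ℂ

theorem inner_torusToL2 (μ : Measure (Fin 2 → Circle)) [IsFiniteMeasure μ]
    (f g : C(Fin 2 → Circle, ℂ)) :
    ⟪torusToL2 μ f, torusToL2 μ g⟫_ℂ = integralCM μ (star f * g) := by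
  rw [ContinuousMap.inner_toLp, integralCM_apply]
  exact integral_congr_ae (ae_of_all _ fun ζ => mul_comm _ _)

theorem orthonormal_torusChar : Orthonormal ℂ fun k => torusToL2 torusHaar (torusChar k) := by
  rw [orthonormal_iff_ite]
  intro k l
  rw [inner_torusToL2, ← torusChar_neg, ← torusChar_add, integralCM_apply]
  split_ifs with h
  · rw [h, neg_add_cancel, integral_torusChar_zero]
  · exact integral_torusChar_of_ne_zero fun h' => h (neg_add_eq_zero.1 h')

/-- The boundary value isometry `H²(𝔻²) → L²(𝕋²)`, which takes the coefficient sequence of a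
function to its Fourier series. -/
def hardyToL2 : HardyBidisk →ₗᵢ[ℂ] Lp ℂ 2 torusHaar :=
  (orthonormal_torusChar.comp natIndex natIndex_injective).orthogonalFamily.linearIsometry

theorem hasSum_hardyToL2 (f : HardyBidisk) :
    HasSum (fun k => f k • torusToL2 torusHaar (torusChar (natIndex k))) (hardyToL2 f) :=
  (orthonormal_torusChar.comp natIndex natIndex_injective).orthogonalFamily.hasSum_linearIsometry f

theorem hardyToL2_single (k : ℕ × ℕ) :
    hardyToL2 (lp.single 2 k 1) = torusToL2 torusHaar (torusChar (natIndex k)) := by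
  refine (hasSum_hardyToL2 _).unique ?_
  convert hasSum_single k ?_ using 1
  · simp
  · intro l hl
    simp [lp.single_apply, hl]

theorem memℓp_kernel (w : bidisk) :
    Memℓp (fun k : ℕ × ℕ => conj (w.1 0 ^ k.1 * w.1 1 ^ k.2)) 2 := by
  refine (memℓp_gen (p := 1) ?_).of_exponent_ge (by norm_num)
  simpa using summable_norm_pow w

/-- The reproducing kernel of `H²(𝔻²)` at `w`. -/
def szegoKernel (w : bidisk) : HardyBidisk := ⟨_, memℓp_kernel w⟩

theorem szegoKernel_apply (w : bidisk) (k : ℕ × ℕ) :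
    szegoKernel w k = conj (w.1 0 ^ k.1 * w.1 1 ^ k.2) := rfl

theorem inner_szegoKernel (w : bidisk) (f : HardyBidisk) :
    ⟪szegoKernel w, f⟫_ℂ = hardyEval f w := by
  rw [lp.inner_eq_tsum, hardyEval]
  refine tsum_congr fun k => ?_
  rw [RCLike.inner_apply, szegoKernel_apply, Complex.conj_conj]

theorem hardyEval_szegoKernel (w : bidisk) {z : Fin 2 → ℂ} (hz : z ∈ bidisk) :
    hardyEval (szegoKernel w) z = cauchyKernel w z :=
  (hasSum_cauchyKernel w z fun j => (hz j).le).tsum_eq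

theorem hardyToL2_szegoKernel (w : bidisk) :
    hardyToL2 (szegoKernel w) = torusToL2 torusHaar (cauchyTorus w) := by
  refine (hasSum_hardyToL2 _).unique ?_
  convert (hasSum_cauchyTorus w).mapL (torusToL2 torusHaar) using 2 with k
  rw [map_smul, szegoKernel_apply]

theorem hardyEval_single (k : ℕ × ℕ) (z : bidisk) :
    hardyEval (lp.single 2 k 1) z = z.1 0 ^ k.1 * z.1 1 ^ k.2 := by
  rw [hardyEval, tsum_eq_single k]
  · simp
  · intro l hl
    simp [lp.single_apply, hl]

/-- The orthogonal projection of a continuous function on the torus to `H²(𝔻²)`, as the adjoint of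
the boundary value isometry. -/
def rieszProj : C(Fin 2 → Circle, ℂ) →L[ℂ] HardyBidisk :=
  (ContinuousLinearMap.adjoint hardyToL2.toContinuousLinearMap).comp (torusToL2 torusHaar)

theorem inner_rieszProj (f : HardyBidisk) (g : C(Fin 2 → Circle, ℂ)) :
    ⟪f, rieszProj g⟫_ℂ = ⟪hardyToL2 f, torusToL2 torusHaar g⟫_ℂ := by
  rw [rieszProj, ContinuousLinearMap.comp_apply, ContinuousLinearMap.adjoint_inner_right]
  rfl

theorem rieszProj_torusChar (k : ℕ × ℕ) :
    rieszProj (torusChar (natIndex k)) = lp.single 2 k 1 := by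
  refine ext_inner_left ℂ fun f => ?_
  rw [inner_rieszProj, ← hardyToL2_single, LinearIsometry.inner_map_map]

theorem hardyToL2_rieszProj {a : C(Fin 2 → Circle, ℂ)} (ha : a ∈ bidiscAlgebra) :
    hardyToL2 (rieszProj a) = torusToL2 torusHaar a := by
  let S : Submodule ℂ C(Fin 2 → Circle, ℂ) := LinearMap.eqLocus
    (hardyToL2.toContinuousLinearMap.comp rieszProj).toLinearMap (torusToL2 torusHaar).toLinearMap
  refine bidiscAlgebra_induction (s := S) (isClosed_eq (ContinuousLinearMap.continuous _)
    (ContinuousLinearMap.continuous _)) (fun P => polyMap_induction (S := S) (fun k => ?_) P) ha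
  change hardyToL2 (rieszProj _) = torusToL2 torusHaar _
  rw [rieszProj_torusChar, hardyToL2_single]

theorem norm_rieszProj {a : C(Fin 2 → Circle, ℂ)} (ha : a ∈ bidiscAlgebra) :
    ‖rieszProj a‖ = ‖torusToL2 torusHaar a‖ := by
  rw [← hardyToL2_rieszProj ha, LinearIsometry.norm_map]

/-- The functional `f ↦ ∫ f conj C_z` on `C(𝕋²)`. On the bidisc algebra it is evaluation at the
point `z` of the bidisc. -/
def cauchyEval (z : bidisk) : C(Fin 2 → Circle, ℂ) →L[ℂ] ℂ :=
  (integralCM torusHaar).comp (ContinuousLinearMap.mul ℂ _ (star (cauchyTorus z)))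

theorem cauchyEval_apply (z : bidisk) (f : C(Fin 2 → Circle, ℂ)) :
    cauchyEval z f = integralCM torusHaar (star (cauchyTorus z) * f) := rfl

theorem hardyEval_rieszProj (f : C(Fin 2 → Circle, ℂ)) (z : bidisk) :
    hardyEval (rieszProj f) z = cauchyEval z f := by
  rw [← inner_szegoKernel, inner_rieszProj, hardyToL2_szegoKernel, inner_torusToL2,
    cauchyEval_apply]

theorem cauchyEval_torusChar (z : bidisk) (k : ℕ × ℕ) :
    cauchyEval z (torusChar (natIndex k)) = z.1 0 ^ k.1 * z.1 1 ^ k.2 := by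
  rw [← hardyEval_rieszProj, rieszProj_torusChar, hardyEval_single]

theorem cauchyEval_polyMap (z : bidisk) (P : MvPolynomial (Fin 2) ℂ) :
    cauchyEval z (polyMap P) = MvPolynomial.eval z.1 P := by
  induction P using MvPolynomial.induction_on' with
  | monomial u c =>
    rw [polyMap_monomial, map_smul, cauchyEval_torusChar, MvPolynomial.eval_monomial,
      Finsupp.prod_fintype _ _ (by simp), Fin.prod_univ_two, smul_eq_mul]
  | add p q hp hq => rw [map_add, map_add, hp, hq, map_add]

/-- `cauchyEval z` is a character of the bidisc algebra, as it is so on the polynomials. -/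
theorem cauchyEval_mul (z : bidisk) {a b : C(Fin 2 → Circle, ℂ)} (ha : a ∈ bidiscAlgebra)
    (hb : b ∈ bidiscAlgebra) : cauchyEval z (a * b) = cauchyEval z a * cauchyEval z b := by
  have hc := (cauchyEval z).continuous
  refine bidiscAlgebra_induction (s := {a | cauchyEval z (a * b) = cauchyEval z a * cauchyEval z b})
    (isClosed_eq (by fun_prop) (by fun_prop)) (fun P => ?_) ha
  refine bidiscAlgebra_induction
    (s := {b | cauchyEval z (polyMap P * b) = cauchyEval z (polyMap P) * cauchyEval z b})
    (isClosed_eq (by fun_prop) (by fun_prop)) (fun Q => ?_) hb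
  simp only [Set.mem_ofPred_eq]
  rw [← map_mul, cauchyEval_polyMap, cauchyEval_polyMap, cauchyEval_polyMap, map_mul]

theorem rieszProj_cauchyTorus (w : bidisk) : rieszProj (cauchyTorus w) = szegoKernel w := by
  refine hardyToL2.injective ?_
  rw [hardyToL2_rieszProj (cauchyTorus_mem w), hardyToL2_szegoKernel]

theorem cauchyEval_cauchyTorus (w z : bidisk) :
    cauchyEval z (cauchyTorus w) = cauchyKernel w z := by
  rw [← hardyEval_rieszProj, ← hardyEval_szegoKernel w z.2, rieszProj_cauchyTorus]

/-- If a closed subspace contains `(1 - t a)⁻¹ g` for all small `t`, then it contains the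
coefficients `aʲ g` of the expansion in powers of `t`. -/
theorem pow_mul_mem_of_inverse_mem {B : Type*} [NormedCommRing B] [NormedAlgebra ℂ B]
    [CompleteSpace B] {S : Submodule ℂ B} (hS : IsClosed (S : Set B)) {a g : B} (ha : ‖a‖ ≤ 1)
    (h : ∀ t : ℂ, ‖t‖ < 1 → Ring.inverse (1 - t • a) * g ∈ S) (j : ℕ) : a ^ j * g ∈ S := by
  have hunit : ∀ t : ℂ, ‖t‖ < 1 → IsUnit (1 - t • a) := fun t ht =>
    isUnit_one_sub_of_norm_lt_one (by
      rw [norm_smul]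
      nlinarith [norm_nonneg t, norm_nonneg a])
  have key : ∀ t : ℂ, ‖t‖ < 1 → a ^ j * (Ring.inverse (1 - t • a) * g) ∈ S := by
    induction j with
    | zero => simpa using h
    | succ j ih =>
      have hne : ∀ t : ℂ, t ≠ 0 → ‖t‖ < 1 →
          a ^ (j + 1) * (Ring.inverse (1 - t • a) * g) ∈ S := by
        intro t ht0 ht
        have h1 : Ring.inverse (1 - t • a) - t • (a * Ring.inverse (1 - t • a)) = 1 := by
          have := Ring.mul_inverse_cancel _ (hunit t ht)
          rw [sub_mul, one_mul, smul_mul_assoc] at this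
          exact this
        have h2 : t • (a ^ (j + 1) * (Ring.inverse (1 - t • a) * g)) =
            a ^ j * (Ring.inverse (1 - t • a) * g) -
              a ^ j * (Ring.inverse (1 - (0 : ℂ) • a) * g) := by
          have h4 : Ring.inverse (1 - t • a) = 1 + t • (a * Ring.inverse (1 - t • a)) :=
            sub_eq_iff_eq_add.1 h1
          rw [zero_smul, sub_zero, Ring.inverse_one, one_mul, ← mul_sub, ← sub_one_mul]
          generalize Ring.inverse (1 - t • a) = G at h4
          have h5 : G - 1 = t • (a * G) := sub_eq_iff_eq_add'.2 h4
          rw [h5, pow_succ]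
          simp only [smul_mul_assoc, mul_smul_comm, mul_assoc]
        have h3 := S.smul_mem t⁻¹ (S.sub_mem (ih t ht) (ih 0 (by simp)))
        rwa [← h2, smul_smul, inv_mul_cancel₀ ht0, one_smul] at h3
      intro t ht
      rcases eq_or_ne t 0 with rfl | ht0
      · have hcont : ContinuousAt
            (fun t : ℂ => a ^ (j + 1) * (Ring.inverse (1 - t • a) * g)) 0 := by
          have h1 : ContinuousAt (fun t : ℂ => Ring.inverse (1 - t • a)) 0 := by
            refine ContinuousAt.comp (g := Ring.inverse) ?_ (by fun_prop)
            obtain ⟨u, hu⟩ := hunit 0 (by simp)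
            rw [← hu]
            exact NormedRing.inverse_continuousAt u
          fun_prop
        refine hS.mem_of_tendsto (hcont.tendsto.mono_left (nhdsWithin_le_nhds (s := {0}ᶜ))) ?_
        have hball : ∀ᶠ t : ℂ in 𝓝[≠] 0, ‖t‖ < 1 :=
          nhdsWithin_le_nhds (by
            filter_upwards [Metric.ball_mem_nhds (0 : ℂ) one_pos] with t ht
            simpa using ht)
        filter_upwards [hball, self_mem_nhdsWithin] with t ht ht0 using hne t ht0 ht
      · exact hne t ht0 ht
  simpa using key 0 (by simp)

theorem inverse_one_sub_smul_torusChar_apply {t : ℂ} (ht : ‖t‖ < 1) (j : Fin 2)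
    (ζ : Fin 2 → Circle) :
    Ring.inverse (1 - t • torusChar (Pi.single j 1)) ζ = 1 / (1 - ζ j * t) := by
  have hu : IsUnit (1 - t • torusChar (Pi.single j 1)) := by
    refine isUnit_one_sub_of_norm_lt_one ?_
    rw [norm_smul]
    have : ‖torusChar (Pi.single j 1)‖ ≤ 1 :=
      (ContinuousMap.norm_le _ zero_le_one).2 fun ζ => (norm_torusChar_apply _ ζ).le
    nlinarith [norm_nonneg t]
  have h := congrArg (fun f => f ζ) (Ring.inverse_mul_cancel _ hu)
  simp only [ContinuousMap.mul_apply, ContinuousMap.sub_apply, ContinuousMap.one_apply,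
    ContinuousMap.smul_apply, torusChar_single, smul_eq_mul] at h
  rw [mul_comm (ζ j : ℂ)]
  exact eq_one_div_of_mul_eq_one_left h

/-- A closed subspace of `C(𝕋²)` that contains the Cauchy kernels contains the bidisc algebra. -/
theorem bidiscAlgebra_le_of_cauchyTorus_mem {S : Submodule ℂ C(Fin 2 → Circle, ℂ)}
    (hS : IsClosed (S : Set C(Fin 2 → Circle, ℂ))) (h : ∀ w, cauchyTorus w ∈ S)
    {a : C(Fin 2 → Circle, ℂ)} (ha : a ∈ bidiscAlgebra) : a ∈ S := by
  refine bidiscAlgebra_induction hS (fun P => polyMap_induction (fun k => ?_) P) ha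
  have hnorm : ∀ j : Fin 2, ‖torusChar (Pi.single j 1)‖ ≤ 1 := fun j =>
    (ContinuousMap.norm_le _ zero_le_one).2 fun ζ => (norm_torusChar_apply _ ζ).le
  rw [torusChar_natIndex, mul_comm]
  refine pow_mul_mem_of_inverse_mem hS (hnorm 1) (fun t ht => ?_) _
  rw [mul_comm]
  refine pow_mul_mem_of_inverse_mem hS (hnorm 0) (fun s hs => ?_) _
  convert h ⟨![conj s, conj t], fun j => by fin_cases j <;> simpa⟩
  ext ζ
  rw [ContinuousMap.mul_apply, inverse_one_sub_smul_torusChar_apply hs,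
    inverse_one_sub_smul_torusChar_apply ht, cauchyTorus_apply, cauchyKernel, Fin.prod_univ_two]
  simp

theorem mem_of_forall_single_mem {S : Submodule ℂ HardyBidisk}
    (hS : IsClosed (S : Set HardyBidisk)) (h : ∀ k : ℕ × ℕ, lp.single 2 k 1 ∈ S)
    (f : HardyBidisk) : f ∈ S := by
  refine hS.mem_of_tendsto (lp.hasSum_single (by norm_num) f) <| Eventually.of_forall fun _ =>
    sum_mem fun k _ => ?_
  convert S.smul_mem (f k) (h k) using 1
  rw [← lp.single_smul]
  simp

/-- A closed subspace of the Hardy space that contains the reproducing kernels is everything. -/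
theorem mem_of_forall_szegoKernel_mem {S : Submodule ℂ HardyBidisk}
    (hS : IsClosed (S : Set HardyBidisk)) (h : ∀ w, szegoKernel w ∈ S) (f : HardyBidisk) :
    f ∈ S := by
  refine mem_of_forall_single_mem hS (fun k => ?_) f
  rw [← rieszProj_torusChar]
  refine bidiscAlgebra_le_of_cauchyTorus_mem (S := S.comap rieszProj.toLinearMap)
    (hS.preimage rieszProj.continuous) (fun w => ?_) (torusChar_natIndex_mem k)
  rw [Submodule.mem_comap]
  exact (rieszProj_cauchyTorus w).symm ▸ h w

/-- A function in the Hardy space is determined by its values on the bidisc. -/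
theorem eq_of_hardyEval_eq {f g : HardyBidisk} (h : ∀ z ∈ bidisk, hardyEval f z = hardyEval g z) :
    f = g := by
  refine ext_inner_right ℂ fun x => ?_
  refine mem_of_forall_szegoKernel_mem (S := LinearMap.eqLocus (innerSL ℂ f).toLinearMap
    (innerSL ℂ g).toLinearMap) (isClosed_eq (ContinuousLinearMap.continuous _)
    (ContinuousLinearMap.continuous _)) (fun w => ?_) x
  change ⟪f, _⟫_ℂ = ⟪g, _⟫_ℂ
  rw [← inner_conj_symm, inner_szegoKernel, h _ w.2, ← inner_szegoKernel, inner_conj_symm]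

/-! ### Polynomials without zeros -/

/-- A polynomial without zeros on the closed bidisc is invertible in the bidisc algebra: by Gelfand
theory, since the characters of the bidisc algebra are evaluations at points of the closed
bidisc. -/
theorem exists_mul_polyMap_eq_one {P : MvPolynomial (Fin 2) ℂ}
    (hP : ∀ z : Fin 2 → ℂ, (∀ j, ‖z j‖ ≤ 1) → MvPolynomial.eval z P ≠ 0) :
    ∃ a ∈ bidiscAlgebra, a * polyMap P = 1 := by
  have : CompleteSpace bidiscAlgebra := isClosed_bidiscAlgebra.completeSpace_coe
  have : NormOneClass bidiscAlgebra := ⟨norm_one (α := C(Fin 2 → Circle, ℂ))⟩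
  have hX : ∀ j, torusChar (Pi.single j 1) ∈ bidiscAlgebra := fun j => by
    convert polyMap_mem (MvPolynomial.X j)
    simp only [polyMap, MvPolynomial.aeval_X]
  have hu : IsUnit (⟨polyMap P, polyMap_mem P⟩ : bidiscAlgebra) := by
    by_contra h
    obtain ⟨φ, hφ⟩ := WeakDual.CharacterSpace.exists_apply_eq_zero h
    let x : Fin 2 → bidiscAlgebra := fun j => ⟨torusChar (Pi.single j 1), hX j⟩
    have hx : (⟨polyMap P, polyMap_mem P⟩ : bidiscAlgebra) = MvPolynomial.aeval x P := by
      refine Subtype.ext ?_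
      change polyMap P = bidiscAlgebra.val (MvPolynomial.aeval x P)
      rw [MvPolynomial.comp_aeval_apply]
      rfl
    let ψ : bidiscAlgebra →ₐ[ℂ] ℂ := WeakDual.CharacterSpace.toAlgHom φ
    have h1 : ψ (MvPolynomial.aeval x P) = 0 := by rw [← hx]; exact hφ
    rw [MvPolynomial.comp_aeval_apply, MvPolynomial.aeval_eq_eval] at h1
    refine hP _ (fun j => ?_) h1
    refine (AlgHom.norm_apply_le_self ψ (x j)).trans ?_
    exact (ContinuousMap.norm_le _ zero_le_one).2 fun ζ => (norm_torusChar_apply _ ζ).le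
  obtain ⟨b, hb⟩ := hu.exists_left_inv
  exact ⟨b, b.2, congrArg Subtype.val hb⟩

/-- A polynomial of degree at most `d` without zeros in the unit disc satisfies a Harnack
inequality: each linear factor `z - a` with `|a| ≥ 1` has
`|z - a| ≤ |z - w| + |w - a| ≤ (1 + |z - w| / (1 - |w|)) |w - a|`. -/
theorem Polynomial.norm_eval_le_of_forall_eval_ne_zero {h : Polynomial ℂ} {d : ℕ}
    (hd : h.natDegree ≤ d) (hz : ∀ z : ℂ, ‖z‖ < 1 → h.eval z ≠ 0) (z : ℂ) {w : ℂ} (hw : ‖w‖ < 1) :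
    ‖h.eval z‖ ≤ (1 + ‖z - w‖ / (1 - ‖w‖)) ^ d * ‖h.eval w‖ := by
  set c : ℝ := 1 + ‖z - w‖ / (1 - ‖w‖) with hc
  have hw' : 0 < 1 - ‖w‖ := sub_pos.2 hw
  have hc1 : 1 ≤ c := by
    have : 0 ≤ ‖z - w‖ / (1 - ‖w‖) := by positivity
    linarith
  have hh : h ≠ 0 := by
    rintro rfl
    exact hz 0 (by simp) (by simp)
  have hs := IsAlgClosed.splits h
  have hroots : ∀ a ∈ h.roots, ‖z - a‖ ≤ c * ‖w - a‖ := by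
    intro a ha
    have ha1 : 1 ≤ ‖a‖ := by
      by_contra! h'
      exact hz a h' ((Polynomial.mem_roots hh).1 ha)
    have h1 : 1 - ‖w‖ ≤ ‖w - a‖ := by
      have := norm_sub_norm_le a w
      rw [norm_sub_rev] at this
      linarith
    have h2 : ‖z - w‖ ≤ ‖z - w‖ / (1 - ‖w‖) * ‖w - a‖ := by
      rw [div_mul_eq_mul_div, le_div_iff₀ hw']
      gcongr
    calc ‖z - a‖ ≤ ‖z - w‖ + ‖w - a‖ := norm_sub_le_norm_sub_add_norm_sub _ _ _
      _ ≤ c * ‖w - a‖ := by rw [hc]; linarith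
  have key : ∀ s : Multiset ℂ, (∀ a ∈ s, ‖z - a‖ ≤ c * ‖w - a‖) →
      ‖(s.map fun a => z - a).prod‖ ≤ c ^ s.card * ‖(s.map fun a => w - a).prod‖ := by
    intro s
    induction s using Multiset.induction_on with
    | empty => simp
    | cons a s ih =>
      intro hs
      simp only [Multiset.map_cons, Multiset.prod_cons, norm_mul, Multiset.card_cons, pow_succ]
      calc _ ≤ (c * ‖w - a‖) * (c ^ s.card * ‖(s.map fun a => w - a).prod‖) := by
            refine mul_le_mul (hs a (by simp)) (ih fun b hb => hs b (by simp [hb]))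
              (norm_nonneg _) (by positivity)
        _ = _ := by ring
  rw [hs.eval_eq_prod_roots, hs.eval_eq_prod_roots, norm_mul, norm_mul, mul_left_comm]
  refine mul_le_mul_of_nonneg_left ((key _ hroots).trans ?_) (norm_nonneg _)
  gcongr
  · exact (Polynomial.card_roots' h).trans hd

/-- On each radius, a polynomial without zeros in the bidisc grows at most by a constant factor. -/
theorem norm_eval_le_radial {q : MvPolynomial (Fin 2) ℂ}
    (hq : ∀ z ∈ bidisk, MvPolynomial.eval z q ≠ 0) {ζ : Fin 2 → ℂ} (hζ : ∀ j, ‖ζ j‖ ≤ 1) {r : ℝ}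
    (hr0 : 0 ≤ r) (hr1 : r < 1) :
    ‖MvPolynomial.eval ζ q‖ ≤ 2 ^ q.totalDegree * ‖MvPolynomial.eval (fun j => r * ζ j) q‖ := by
  let h : Polynomial ℂ := MvPolynomial.aeval (fun j => Polynomial.C (ζ j) * Polynomial.X) q
  have hev : ∀ t : ℂ, h.eval t = MvPolynomial.eval (fun j => t * ζ j) q := by
    intro t
    change Polynomial.aeval t h = _
    rw [MvPolynomial.comp_aeval_apply, MvPolynomial.aeval_eq_eval]
    simp [mul_comm t]
  have hdeg : h.natDegree ≤ q.totalDegree * 1 :=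
    MvPolynomial.aeval_natDegree_le q le_rfl _ fun j => by
      simpa using Polynomial.natDegree_C_mul_X_pow_le (ζ j) 1
  rw [mul_one] at hdeg
  have key := Polynomial.norm_eval_le_of_forall_eval_ne_zero hdeg (fun t ht => ?_) 1 (w := r)
    (by rwa [Complex.norm_real, Real.norm_of_nonneg hr0])
  · have h1 : ‖(1 : ℂ) - r‖ = 1 - r := by
      rw [← Complex.ofReal_one, ← Complex.ofReal_sub, Complex.norm_real,
        Real.norm_of_nonneg (by linarith)]
    rw [h1, Complex.norm_real, Real.norm_of_nonneg hr0, div_self (by linarith), hev, hev] at key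
    norm_num at key
    exact key
  · rw [hev]
    refine hq _ fun j => ?_
    rw [norm_mul]
    nlinarith [norm_nonneg t, norm_nonneg (ζ j), hζ j]

/-- The Harnack inequality in one of the two variables, the other being in the closed disc. In
particular a polynomial without zeros in `𝔻²` that vanishes at one point of a disc
`{zⱼ ∈ 𝔻, zᵢ = τ}` vanishes on the whole disc. -/
theorem norm_eval_update_le {q : MvPolynomial (Fin 2) ℂ}
    (hq : ∀ z ∈ bidisk, MvPolynomial.eval z q ≠ 0) {ζ : Fin 2 → ℂ} (hζ : ∀ j, ‖ζ j‖ ≤ 1)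
    (j : Fin 2) (a : ℂ) {b : ℂ} (hb : ‖b‖ < 1) :
    ‖MvPolynomial.eval (Function.update ζ j a) q‖ ≤
      (1 + ‖a - b‖ / (1 - ‖b‖)) ^ q.totalDegree *
        ‖MvPolynomial.eval (Function.update ζ j b) q‖ := by
  -- the inequality for `r ζ` in place of `ζ`, and then `r → 1`
  have hr : ∀ r : ℝ, 0 ≤ r → r < 1 →
      ‖MvPolynomial.eval (Function.update (fun i => (r : ℂ) * ζ i) j a) q‖ ≤
      (1 + ‖a - b‖ / (1 - ‖b‖)) ^ q.totalDegree *
        ‖MvPolynomial.eval (Function.update (fun i => (r : ℂ) * ζ i) j b) q‖ := by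
    intro r hr0 hr1
    let h : Polynomial ℂ := MvPolynomial.aeval
      (Function.update (fun i => Polynomial.C ((r : ℂ) * ζ i)) j Polynomial.X) q
    have hev : ∀ t : ℂ, h.eval t =
        MvPolynomial.eval (Function.update (fun i => (r : ℂ) * ζ i) j t) q := by
      intro t
      change Polynomial.aeval t h = _
      rw [MvPolynomial.comp_aeval_apply, MvPolynomial.aeval_eq_eval]
      congr 2
      ext i
      rcases eq_or_ne i j with rfl | hi
      · simp
      · simp [Function.update_of_ne hi]
    have hdeg : h.natDegree ≤ q.totalDegree * 1 := by
      refine MvPolynomial.aeval_natDegree_le q le_rfl _ fun i => ?_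
      rcases eq_or_ne i j with rfl | hi
      · simp
      · rw [Function.update_of_ne hi, Polynomial.natDegree_C]
        exact zero_le_one
    rw [mul_one] at hdeg
    rw [← hev, ← hev]
    refine Polynomial.norm_eval_le_of_forall_eval_ne_zero hdeg (fun t ht => ?_) a hb
    rw [hev]
    refine hq _ fun i => ?_
    rcases eq_or_ne i j with rfl | hi
    · simpa
    · rw [Function.update_of_ne hi, norm_mul, Complex.norm_real, Real.norm_of_nonneg hr0]
      nlinarith [norm_nonneg (ζ i), hζ i]
  have hcont : ∀ t : ℂ, Continuous fun r : ℝ =>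
      MvPolynomial.eval (Function.update (fun i => (r : ℂ) * ζ i) j t) q := fun t =>
    q.continuous_eval.comp (Continuous.update (by fun_prop) j continuous_const)
  have htend : ∀ t : ℂ, Tendsto
      (fun r : ℝ => ‖MvPolynomial.eval (Function.update (fun i => (r : ℂ) * ζ i) j t) q‖) (𝓝[<] 1)
      (𝓝 ‖MvPolynomial.eval (Function.update ζ j t) q‖) := by
    intro t
    have := ((hcont t).norm.tendsto 1).mono_left (nhdsWithin_le_nhds (s := Set.Iio 1))
    simpa using this
  refine le_of_tendsto_of_tendsto (htend a) ((htend b).const_mul _) ?_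
  filter_upwards [Ioo_mem_nhdsLT (zero_lt_one' ℝ)] with r hr'
  exact hr r hr'.1.le hr'.2

/-- The factor theorem: a polynomial that vanishes for `zⱼ = c` is divisible by `zⱼ - c`. -/
theorem MvPolynomial.X_sub_C_dvd_of_forall_eval_update {P : MvPolynomial (Fin 2) ℂ} {j : Fin 2}
    {c : ℂ} {s : Fin 2 → Set ℂ} (hs : ∀ i, (s i).Infinite)
    (h : ∀ z ∈ Set.pi .univ s, MvPolynomial.eval (Function.update z j c) P = 0) :
    MvPolynomial.X j - MvPolynomial.C c ∣ P := by
  let σ : Fin 2 → MvPolynomial (Fin 2) ℂ := Function.update MvPolynomial.X j (MvPolynomial.C c)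
  have h0 : MvPolynomial.aeval σ P = 0 := by
    refine MvPolynomial.funext_set s hs fun z hz => ?_
    rw [map_zero, ← h z hz, ← MvPolynomial.aeval_eq_eval, MvPolynomial.comp_aeval_apply]
    rw [MvPolynomial.aeval_eq_eval]
    congr 2
    ext i
    rcases eq_or_ne i j with rfl | hi
    · simp [σ]
    · simp [σ, Function.update_of_ne hi]
  let I := Ideal.span {(MvPolynomial.X j - MvPolynomial.C c : MvPolynomial (Fin 2) ℂ)}
  have h1 : (Ideal.Quotient.mkₐ ℂ I) = (Ideal.Quotient.mkₐ ℂ I).comp (MvPolynomial.aeval σ) := by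
    refine MvPolynomial.algHom_ext fun i => ?_
    rw [AlgHom.comp_apply, MvPolynomial.aeval_X]
    rcases eq_or_ne i j with rfl | hi
    · simp only [σ, Function.update_self]
      exact Ideal.Quotient.eq.2 (Ideal.subset_span rfl)
    · simp only [σ, Function.update_of_ne hi]
  have h2 := DFunLike.congr_fun h1 P
  rw [AlgHom.comp_apply, h0, map_zero] at h2
  exact Ideal.mem_span_singleton.1 (Ideal.Quotient.eq_zero_iff_mem.1 h2)

/-! ### Boundary behaviour of the numerator and the denominator -/

theorem IsRIFDenominator.eval_reflectPoly_torus {m n : ℕ} {p : MvPolynomial (Fin 2) ℂ}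
    (hp : IsRIFDenominator m n p) (ζ : Fin 2 → Circle) :
    MvPolynomial.eval (fun j => (ζ j : ℂ)) (reflectPoly m n p) =
      (ζ 0 : ℂ) ^ m * (ζ 1 : ℂ) ^ n * conj (MvPolynomial.eval (fun j => (ζ j : ℂ)) p) := by
  rw [eval_reflectPoly m n p hp.degreeOf_zero_le hp.degreeOf_one_le _
    fun j => Circle.coe_ne_zero (ζ j)]
  congr 4
  ext j
  rw [← Circle.coe_inv_eq_conj, Circle.coe_inv, one_div, inv_inv]

theorem IsRIFDenominator.norm_eval_reflectPoly_torus {m n : ℕ} {p : MvPolynomial (Fin 2) ℂ}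
    (hp : IsRIFDenominator m n p) (ζ : Fin 2 → Circle) :
    ‖MvPolynomial.eval (fun j => (ζ j : ℂ)) (reflectPoly m n p)‖ =
      ‖MvPolynomial.eval (fun j => (ζ j : ℂ)) p‖ := by
  rw [hp.eval_reflectPoly_torus]
  simp [Circle.norm_coe]

theorem infinite_range_circle : (Set.range fun ζ : Circle => (ζ : ℂ)).Infinite := by
  have : Infinite Circle := Set.infinite_univ_iff.1 <|
    isPreconnected_univ.infinite_of_nontrivial ⟨1, trivial, -1, trivial, fun h =>
      Circle.neg_ne_self 1 h.symm⟩
  exact Set.infinite_range_of_injective Circle.coe_injective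

/-- The denominator has no zeros on the discs `{zⱼ ∈ 𝔻, zᵢ = τ}` with `|τ| = 1`: otherwise it
would vanish on such a disc, hence be divisible by `zᵢ - τ`, and so would the numerator. -/
theorem IsRIFDenominator.eval_update_ne_zero {m n : ℕ} {p : MvPolynomial (Fin 2) ℂ}
    (hp : IsRIFDenominator m n p) (ζ : Fin 2 → Circle) {i j : Fin 2} (hij : i ≠ j) {b : ℂ}
    (hb : ‖b‖ < 1) :
    MvPolynomial.eval (Function.update (fun i => (ζ i : ℂ)) j b) p ≠ 0 := by
  intro h0
  have hall : ∀ a, MvPolynomial.eval (Function.update (fun i => (ζ i : ℂ)) j a) p = 0 := by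
    intro a
    have := norm_eval_update_le hp.stable (fun i => (Circle.norm_coe (ζ i)).le) j a hb
    rw [h0, norm_zero, mul_zero] at this
    exact norm_le_zero_iff.1 this
  have hupd : ∀ z : Fin 2 → ℂ,
      Function.update z i (ζ i : ℂ) = Function.update (fun i => (ζ i : ℂ)) j (z j) := by
    intro z
    ext k
    rcases eq_or_ne k j with rfl | hk
    · rw [Function.update_self, Function.update_of_ne hij.symm]
    · obtain rfl : k = i := by omega
      rw [Function.update_self, Function.update_of_ne hk]
  have hs : ∀ _ : Fin 2, (Set.range fun ζ : Circle => (ζ : ℂ)).Infinite :=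
    fun _ => infinite_range_circle
  have hd1 : MvPolynomial.X i - MvPolynomial.C (ζ i : ℂ) ∣ p :=
    MvPolynomial.X_sub_C_dvd_of_forall_eval_update hs fun z _ => by rw [hupd, hall]
  have hd2 : MvPolynomial.X i - MvPolynomial.C (ζ i : ℂ) ∣ reflectPoly m n p := by
    refine MvPolynomial.X_sub_C_dvd_of_forall_eval_update hs fun z hz => ?_
    obtain ⟨η, hη⟩ := hz j (Set.mem_univ j)
    beta_reduce at hη
    have h1 := hp.norm_eval_reflectPoly_torus (Function.update ζ j η)
    have h2 : (fun k => ((Function.update ζ j η) k : ℂ)) =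
        Function.update (fun i => (ζ i : ℂ)) j (z j) := by
      ext k
      rcases eq_or_ne k j with rfl | hk
      · rw [Function.update_self, Function.update_self]
        exact hη
      · simp only [Function.update_of_ne hk]
    rw [h2, hall, norm_zero, norm_eq_zero] at h1
    rw [hupd, h1]
  have hu := hp.isRelPrime hd1 hd2
  have := hu.map (MvPolynomial.eval (fun i => (ζ i : ℂ)))
  simp at this

/-! ### Multiplication by `φ` is an isometry of the Hardy space -/

/-- For a bounded family `y` in a Hilbert space, the vectors against which `y` converges weakly
to `y₀` form a closed subspace. -/
theorem tendsto_inner_of_forall_mem {H ι : Type*} [NormedAddCommGroup H] [InnerProductSpace ℂ H]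
    {l : Filter ι} {y : ι → H} {y₀ : H} {c : ℝ} (hc : ∀ᶠ i in l, ‖y i‖ ≤ c) :
    ∃ S : Submodule ℂ H, IsClosed (S : Set H) ∧
      ∀ x, x ∈ S ↔ Tendsto (fun i => ⟪x, y i⟫_ℂ) l (𝓝 ⟪x, y₀⟫_ℂ) := by
  refine ⟨{ carrier := {x | Tendsto (fun i => ⟪x, y i⟫_ℂ) l (𝓝 ⟪x, y₀⟫_ℂ)}
            zero_mem' := by simpa using tendsto_const_nhds
            add_mem' := fun hx hx' => by
              simpa only [Set.mem_ofPred_eq, inner_add_left] using hx.add hx'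
            smul_mem' := fun a x hx => by
              simpa only [Set.mem_ofPred_eq, inner_smul_left] using hx.const_mul _ },
    ?_, fun x => Iff.rfl⟩
  refine isClosed_of_closure_subset fun x hx => ?_
  change Tendsto _ _ _
  rw [Metric.tendsto_nhds]
  intro ε hε
  set b : ℝ := max c 0 + ‖y₀‖ + 1 with hb
  have hb0 : 0 < b := by positivity
  obtain ⟨x', hx', hxx'⟩ := Metric.mem_closure_iff.1 hx (ε / (2 * b)) (by positivity)
  have hx'' : Tendsto (fun i => ⟪x', y i⟫_ℂ) l (𝓝 ⟪x', y₀⟫_ℂ) := hx'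
  filter_upwards [hc, Metric.tendsto_nhds.1 hx'' (ε / 2) (by positivity)] with i hi hi'
  rw [dist_eq_norm] at hi' hxx' ⊢
  have h1 : ⟪x, y i⟫_ℂ - ⟪x, y₀⟫_ℂ = ⟪x - x', y i - y₀⟫_ℂ + (⟪x', y i⟫_ℂ - ⟪x', y₀⟫_ℂ) := by
    simp only [inner_sub_left, inner_sub_right]
    ring
  have h2 : ‖y i - y₀‖ ≤ b := by
    refine (norm_sub_le _ _).trans ?_
    have := le_max_left c 0
    linarith
  have h3 : ‖⟪x - x', y i - y₀⟫_ℂ‖ ≤ ε / 2 := by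
    calc _ ≤ ‖x - x'‖ * ‖y i - y₀‖ := norm_inner_le_norm _ _
      _ ≤ ε / (2 * b) * b := by gcongr
      _ = ε / 2 := by field_simp
  rw [h1]
  exact (norm_add_le _ _).trans_lt (by linarith)

/-- The polynomial `p(r z)`. -/
def dilatePoly (r : ℝ) (p : MvPolynomial (Fin 2) ℂ) : MvPolynomial (Fin 2) ℂ :=
  MvPolynomial.aeval (fun j => MvPolynomial.C (r : ℂ) * MvPolynomial.X j) p

theorem eval_dilatePoly (r : ℝ) (p : MvPolynomial (Fin 2) ℂ) (z : Fin 2 → ℂ) :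
    MvPolynomial.eval z (dilatePoly r p) = MvPolynomial.eval (fun j => r * z j) p := by
  rw [dilatePoly, ← MvPolynomial.aeval_eq_eval, MvPolynomial.comp_aeval_apply,
    MvPolynomial.aeval_eq_eval]
  simp

theorem mul_mem_bidisk {r : ℝ} (hr0 : 0 ≤ r) (hr1 : r < 1) {z : Fin 2 → ℂ}
    (hz : ∀ j, ‖z j‖ ≤ 1) : (fun j => r * z j) ∈ bidisk := fun j => by
  rw [norm_mul, Complex.norm_real, Real.norm_of_nonneg hr0]
  nlinarith [norm_nonneg (z j), hz j]

theorem exists_mul_dilatePoly_eq_one {p : MvPolynomial (Fin 2) ℂ}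
    (hp : ∀ z ∈ bidisk, MvPolynomial.eval z p ≠ 0) {r : ℝ} (hr0 : 0 ≤ r) (hr1 : r < 1) :
    ∃ a ∈ bidiscAlgebra, a * polyMap (dilatePoly r p) = 1 :=
  exists_mul_polyMap_eq_one fun z hz => by
    rw [eval_dilatePoly]
    exact hp _ (mul_mem_bidisk hr0 hr1 hz)

theorem tendsto_eval_dilate (p : MvPolynomial (Fin 2) ℂ) (z : Fin 2 → ℂ) :
    Tendsto (fun r : ℝ => MvPolynomial.eval (fun j => r * z j) p) (𝓝[<] 1)
      (𝓝 (MvPolynomial.eval z p)) := by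
  have hcont : Continuous fun r : ℝ => MvPolynomial.eval (fun j => (r : ℂ) * z j) p :=
    p.continuous_eval.comp (by fun_prop)
  simpa using (hcont.tendsto 1).mono_left (nhdsWithin_le_nhds (s := Set.Iio 1))

/-- A polynomial without zeros in the bidisc is cyclic in the Hardy space: `p(z) / p(r z)` stays
bounded on the torus as `r → 1`, and it converges to `1` in the bidisc, hence weakly. -/
theorem denseRange_mul_polyMap {p : MvPolynomial (Fin 2) ℂ}
    (hp : ∀ z ∈ bidisk, MvPolynomial.eval z p ≠ 0) :
    DenseRange fun a : bidiscAlgebra => rieszProj (polyMap p * a) := by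
  let T : bidiscAlgebra →ₗ[ℂ] HardyBidisk :=
    (rieszProj.toLinearMap.comp (LinearMap.mulLeft ℂ (polyMap p))).comp
      bidiscAlgebra.val.toLinearMap
  suffices h : (LinearMap.range T).topologicalClosure = ⊤ by
    intro x
    have : x ∈ (LinearMap.range T).topologicalClosure := h ▸ Submodule.mem_top
    exact this
  rw [Submodule.topologicalClosure_eq_top_iff, Submodule.eq_bot_iff]
  intro g hg
  rw [Submodule.mem_orthogonal'] at hg
  have hinv : ∀ r : ℝ, ∃ a ∈ bidiscAlgebra,
      0 ≤ r → r < 1 → a * polyMap (dilatePoly r p) = 1 := by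
    intro r
    by_cases hr : 0 ≤ r ∧ r < 1
    · obtain ⟨a, ha, h⟩ := exists_mul_dilatePoly_eq_one hp hr.1 hr.2
      exact ⟨a, ha, fun _ _ => h⟩
    · exact ⟨0, zero_mem _, fun h0 h1 => absurd ⟨h0, h1⟩ hr⟩
  choose a ha hap using hinv
  have hIoo : ∀ᶠ r : ℝ in 𝓝[<] 1, 0 ≤ r ∧ r < 1 := by
    filter_upwards [Ioo_mem_nhdsLT (zero_lt_one' ℝ)] with r hr using ⟨hr.1.le, hr.2⟩
  have horth : ∀ k, ⟪g, (lp.single 2 k 1 : HardyBidisk)⟫_ℂ = 0 := by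
    intro k
    let χ := torusChar (natIndex k)
    have hmem : ∀ r, χ * a r ∈ bidiscAlgebra := fun r => mul_mem (torusChar_natIndex_mem k) (ha r)
    let y : ℝ → HardyBidisk := fun r => T ⟨χ * a r, hmem r⟩
    have hy : ∀ r, y r = rieszProj (polyMap p * (χ * a r)) := fun r => rfl
    have hbdd : ∀ᶠ r in 𝓝[<] 1, ‖y r‖ ≤ ‖rieszProj‖ * 2 ^ p.totalDegree := by
      filter_upwards [hIoo] with r hr
      rw [hy]
      refine (rieszProj.le_opNorm _).trans ?_
      gcongr
      refine (ContinuousMap.norm_le _ (by positivity)).2 fun ζ => ?_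
      have h1 := congrArg (fun f => ‖f ζ‖) (hap r hr.1 hr.2)
      simp only [ContinuousMap.mul_apply, ContinuousMap.one_apply, norm_mul, norm_one,
        polyMap_apply, eval_dilatePoly] at h1
      rw [ContinuousMap.mul_apply, ContinuousMap.mul_apply, norm_mul, norm_mul,
        norm_torusChar_apply, one_mul, polyMap_apply]
      calc _ ≤ (2 ^ p.totalDegree * ‖MvPolynomial.eval (fun j => (r : ℂ) * ζ j) p‖) * ‖a r ζ‖ := by
            gcongr
            exact norm_eval_le_radial hp (fun j => (Circle.norm_coe _).le) hr.1 hr.2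
        _ = 2 ^ p.totalDegree := by rw [mul_assoc, mul_comm _ ‖a r ζ‖, h1, mul_one]
    obtain ⟨S, hSc, hS⟩ := tendsto_inner_of_forall_mem (y₀ := (lp.single 2 k 1 : HardyBidisk)) hbdd
    have hgS : g ∈ S := by
      refine mem_of_forall_szegoKernel_mem hSc (fun w => ?_) g
      rw [hS, inner_szegoKernel, hardyEval_single]
      have hw := hp _ w.2
      have hlim : Tendsto (fun r : ℝ => MvPolynomial.eval w.1 p * (w.1 0 ^ k.1 * w.1 1 ^ k.2 *
          (MvPolynomial.eval (fun j => r * w.1 j) p)⁻¹)) (𝓝[<] 1)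
          (𝓝 (MvPolynomial.eval w.1 p * (w.1 0 ^ k.1 * w.1 1 ^ k.2 *
            (MvPolynomial.eval w.1 p)⁻¹))) :=
        (((tendsto_eval_dilate p w.1).inv₀ hw).const_mul _).const_mul _
      have h2 : MvPolynomial.eval w.1 p * (w.1 0 ^ k.1 * w.1 1 ^ k.2 *
            (MvPolynomial.eval w.1 p)⁻¹) = w.1 0 ^ k.1 * w.1 1 ^ k.2 := by field_simp
      rw [h2] at hlim
      refine hlim.congr' ?_
      filter_upwards [hIoo] with r hr
      have h1 := congrArg (cauchyEval w) (hap r hr.1 hr.2)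
      rw [cauchyEval_mul w (ha r) (polyMap_mem _), cauchyEval_polyMap, eval_dilatePoly,
        ← map_one polyMap, cauchyEval_polyMap, map_one] at h1
      rw [inner_szegoKernel, hy, hardyEval_rieszProj, cauchyEval_mul w (polyMap_mem p) (hmem r),
        cauchyEval_mul w (torusChar_natIndex_mem k) (ha r), cauchyEval_polyMap,
        cauchyEval_torusChar, eq_inv_of_mul_eq_one_left h1]
    have h0 : ∀ r, ⟪g, y r⟫_ℂ = 0 := fun r => hg _ ⟨_, rfl⟩
    refine tendsto_nhds_unique (((hS g).1 hgS).congr h0) tendsto_const_nhds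
  refine ext_inner_right ℂ fun x => ?_
  rw [inner_zero_left]
  exact mem_of_forall_single_mem (S := LinearMap.ker (innerSL ℂ g).toLinearMap)
    (isClosed_eq (ContinuousLinearMap.continuous _) continuous_const) horth x

theorem norm_torusToL2_congr (μ : Measure (Fin 2 → Circle)) [IsFiniteMeasure μ]
    {f g : C(Fin 2 → Circle, ℂ)} (h : ∀ ζ, ‖f ζ‖ = ‖g ζ‖) : ‖torusToL2 μ f‖ = ‖torusToL2 μ g‖ := by
  have h1 : star f * f = star g * g := by
    ext ζ
    simp only [ContinuousMap.mul_apply, ContinuousMap.star_apply, RCLike.star_def,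
      RCLike.conj_mul, h]
  rw [@norm_eq_sqrt_re_inner ℂ, @norm_eq_sqrt_re_inner ℂ, inner_torusToL2, inner_torusToL2, h1]

/-- Multiplication by a rational inner function is an isometry of the Hardy space: as `|p̃| = |p|`
on the torus, `p a ↦ p̃ a` is isometric for `a` in the bidisc algebra, and the functions `p a` are
dense. -/
theorem IsRIFDenominator.exists_isometry {m n : ℕ} {p : MvPolynomial (Fin 2) ℂ}
    (hp : IsRIFDenominator m n p) : ∃ V : HardyBidisk →ₗᵢ[ℂ] HardyBidisk,
      ∀ f, ∀ z ∈ bidisk, hardyEval (V f) z = rif m n p z * hardyEval f z := by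
  let T : MvPolynomial (Fin 2) ℂ → bidiscAlgebra →ₗ[ℂ] HardyBidisk := fun q =>
    (rieszProj.toLinearMap.comp (LinearMap.mulLeft ℂ (polyMap q))).comp
      bidiscAlgebra.val.toLinearMap
  have hT : ∀ q a, T q a = rieszProj (polyMap q * a) := fun q a => rfl
  have hdense : DenseRange (T p) := denseRange_mul_polyMap hp.stable
  have hnorm : ∀ a, ‖T (reflectPoly m n p) a‖ = ‖T p a‖ := by
    intro a
    rw [hT, hT, norm_rieszProj (mul_mem (polyMap_mem _) a.2),
      norm_rieszProj (mul_mem (polyMap_mem _) a.2)]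
    refine norm_torusToL2_congr _ fun ζ => ?_
    rw [ContinuousMap.mul_apply, ContinuousMap.mul_apply, norm_mul, norm_mul, polyMap_apply,
      polyMap_apply, hp.norm_eval_reflectPoly_torus]
  let V := (T (reflectPoly m n p)).extendOfNorm (T p)
  have hV : ∀ a, V (T p a) = T (reflectPoly m n p) a := fun a =>
    LinearMap.extendOfNorm_eq hdense ⟨1, fun x => by rw [one_mul, hnorm]⟩ a
  refine ⟨⟨V.toLinearMap, fun x => ?_⟩, fun f z hz => ?_⟩
  · refine hdense.induction_on (p := fun x => ‖V x‖ = ‖x‖) x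
      (isClosed_eq (by fun_prop) (by fun_prop)) fun a => ?_
    rw [hV, hnorm]
  · change hardyEval (V f) z = _
    have hcont : ∀ f, hardyEval f z = innerSL ℂ (szegoKernel ⟨z, hz⟩) f := fun f =>
      (inner_szegoKernel ⟨z, hz⟩ f).symm
    refine hdense.induction_on (p := fun f => hardyEval (V f) z = rif m n p z * hardyEval f z) f
      ?_ fun a => ?_
    · simp only [hcont]
      exact isClosed_eq (by fun_prop) (by fun_prop)
    · rw [hV, hT, hT, hardyEval_rieszProj _ ⟨z, hz⟩, hardyEval_rieszProj _ ⟨z, hz⟩,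
        cauchyEval_mul _ (polyMap_mem _) a.2, cauchyEval_mul _ (polyMap_mem _) a.2,
        cauchyEval_polyMap, cauchyEval_polyMap, rif, div_mul_eq_mul_div, mul_div_assoc,
        mul_div_cancel_left₀ _ (hp.stable z hz)]

/-! ### The reproducing kernels of the model space -/

theorem cauchyKernel_ne_zero {w z : Fin 2 → ℂ} (hw : w ∈ bidisk) (hz : ∀ j, ‖z j‖ ≤ 1) :
    cauchyKernel w z ≠ 0 :=
  Finset.prod_ne_zero_iff.2 fun j _ => one_div_ne_zero (one_sub_mul_conj_ne_zero (hz j) (hw j))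

theorem cauchyKernel_self (w : Fin 2 → ℂ) :
    cauchyKernel w w = ((∏ j, 1 / (1 - ‖w j‖ ^ 2) : ℝ) : ℂ) := by
  simp [cauchyKernel, RCLike.mul_conj]

theorem cauchyKernel_self_pos {w : Fin 2 → ℂ} (hw : w ∈ bidisk) :
    0 < ∏ j, 1 / (1 - ‖w j‖ ^ 2) :=
  Finset.prod_pos fun j _ => one_div_pos.2 (by nlinarith [hw j, norm_nonneg (w j)])

theorem conj_cauchyKernel (w z : Fin 2 → ℂ) : conj (cauchyKernel w z) = cauchyKernel z w := by
  simp [cauchyKernel, mul_comm]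

/-- The reproducing kernels `K_w = C_w - conj φ(w) φ C_w` of the model space. They are orthogonal to
`φ H²` because multiplication by `φ` is an isometry. -/
theorem IsRIFDenominator.exists_modelKernel {m n : ℕ} {p : MvPolynomial (Fin 2) ℂ}
    (hp : IsRIFDenominator m n p) : ∃ K : bidisk → modelSpace (rif m n p),
      (∀ w, ∀ z ∈ bidisk, hardyEval (K w) z =
        (1 - conj (rif m n p w) * rif m n p z) * cauchyKernel w z) ∧
      ∀ w f, ⟪K w, f⟫_ℂ = hardyEval f w := by
  obtain ⟨V, hV⟩ := hp.exists_isometry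
  have hVmem : ∀ g, V g ∈ multiplierRange (rif m n p) := fun g => ⟨g, hV g⟩
  have hmem : ∀ w : bidisk, szegoKernel w - conj (rif m n p w) • V (szegoKernel w) ∈
      modelSpace (rif m n p) := by
    intro w
    rw [modelSpace, Submodule.mem_orthogonal]
    rintro f ⟨g, hg⟩
    obtain rfl : f = V g := eq_of_hardyEval_eq fun z hz => by rw [hg z hz, hV g z hz]
    rw [inner_sub_right, inner_smul_right, LinearIsometry.inner_map_map, ← inner_conj_symm,
      inner_szegoKernel, ← inner_conj_symm, inner_szegoKernel, hV g w w.2, map_mul, sub_self]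
  have hsub : ∀ (z : bidisk) (f g : HardyBidisk), hardyEval (f - g) z =
      hardyEval f z - hardyEval g z := fun z f g => by
    simp only [← inner_szegoKernel, inner_sub_right]
  have hsmul : ∀ (z : bidisk) (c : ℂ) (f : HardyBidisk),
      hardyEval (c • f) z = c * hardyEval f z := fun z c f => by
    simp only [← inner_szegoKernel, inner_smul_right]
  refine ⟨fun w => ⟨_, hmem w⟩, fun w z hz => ?_, fun w f => ?_⟩
  · change hardyEval (szegoKernel w - conj (rif m n p w) • V (szegoKernel w)) z = _
    rw [hsub ⟨z, hz⟩, hsmul ⟨z, hz⟩, hV _ _ hz, hardyEval_szegoKernel w hz]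
    ring
  · have hf : ⟪V (szegoKernel w), (f : HardyBidisk)⟫_ℂ = 0 :=
      (Submodule.mem_orthogonal _ _).1 f.2 _ (hVmem _)
    rw [Submodule.coe_inner, inner_sub_left, inner_smul_left, hf, mul_zero, sub_zero,
      inner_szegoKernel]

theorem infinite_ball : (Metric.ball (0 : ℂ) 1).Infinite :=
  infinite_of_mem_nhds 0 (Metric.ball_mem_nhds 0 one_pos)

/-- A rational inner function of positive bidegree is strictly bounded by `1` in the bidisc:
otherwise a reproducing kernel of the model space vanishes, and `φ` is constant. -/
theorem IsRIFDenominator.norm_rif_lt_one {m n : ℕ} (hm : 0 < m) {p : MvPolynomial (Fin 2) ℂ}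
    (hp : IsRIFDenominator m n p) {w : Fin 2 → ℂ} (hw : w ∈ bidisk) : ‖rif m n p w‖ < 1 := by
  obtain ⟨K, hK, hKf⟩ := hp.exists_modelKernel
  have h1 : ⟪K ⟨w, hw⟩, K ⟨w, hw⟩⟫_ℂ = ((‖K ⟨w, hw⟩‖ ^ 2 : ℝ) : ℂ) := by
    refine (inner_self_eq_norm_sq_to_K (𝕜 := ℂ) (K ⟨w, hw⟩)).trans ?_
    rw [Complex.ofReal_pow]
    rfl
  rw [hKf, hK _ _ hw, Complex.conj_mul', cauchyKernel_self] at h1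
  have h2 : ‖K ⟨w, hw⟩‖ ^ 2 = (1 - ‖rif m n p w‖ ^ 2) * ∏ j, 1 / (1 - ‖w j‖ ^ 2) := by
    exact_mod_cast h1.symm
  have hpos := cauchyKernel_self_pos hw
  have hle : 0 ≤ 1 - ‖rif m n p w‖ ^ 2 := by
    refine nonneg_of_mul_nonneg_left (b := ∏ j, 1 / (1 - ‖w j‖ ^ 2)) ?_ hpos
    rw [← h2]
    positivity
  by_contra! hge
  have heq : ‖rif m n p w‖ ^ 2 = 1 := by nlinarith
  have hK0 : K ⟨w, hw⟩ = 0 := by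
    rw [heq, sub_self, zero_mul] at h2
    exact norm_eq_zero.1 (pow_eq_zero_iff two_ne_zero |>.1 h2)
  have hconst : ∀ z ∈ bidisk, rif m n p z = rif m n p w := by
    intro z hz
    have h3 := hK ⟨w, hw⟩ z hz
    rw [hK0, ← inner_szegoKernel ⟨z, hz⟩, Submodule.coe_zero, inner_zero_right] at h3
    have h4 := (mul_eq_zero.1 h3.symm).resolve_right
      (cauchyKernel_ne_zero hw fun j => (hz j).le)
    have h5 : conj (rif m n p w) * rif m n p w = 1 := by
      rw [Complex.conj_mul']
      exact_mod_cast heq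
    have h6 : conj (rif m n p w) ≠ 0 := left_ne_zero_of_mul_eq_one h5
    exact mul_left_cancel₀ h6 (by rw [h5, ← sub_eq_zero.1 h4])
  have hpoly : reflectPoly m n p = p * MvPolynomial.C (rif m n p w) := by
    refine MvPolynomial.funext_set (fun _ => Metric.ball (0 : ℂ) 1) (fun _ => infinite_ball)
      fun z hz => ?_
    have hz' : z ∈ bidisk := fun j => by simpa using hz j (Set.mem_univ j)
    rw [map_mul, MvPolynomial.eval_C, ← hconst z hz', rif, mul_div_cancel₀ _ (hp.stable z hz')]
  -- `p` divides its reflection, so it is constant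
  have hunit := hp.isRelPrime dvd_rfl (hpoly ▸ dvd_mul_right p _)
  obtain ⟨c, hc, hpc⟩ := MvPolynomial.isUnit_iff_eq_C_of_isReduced.1 hunit
  have h7 := eval_reflectPoly m n p hp.degreeOf_zero_le hp.degreeOf_one_le ![1, 1]
    (fun j => by fin_cases j <;> simp)
  have h8 := eval_reflectPoly m n p hp.degreeOf_zero_le hp.degreeOf_one_le ![2, 1]
    (fun j => by fin_cases j <;> simp)
  rw [hpoly, hpc] at h7 h8
  simp only [map_mul, MvPolynomial.eval_C, Matrix.cons_val_zero, Matrix.cons_val_one, one_pow,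
    one_mul, mul_one] at h7 h8
  rw [h7] at h8
  have h9 : conj c ≠ 0 := by simpa using hc.ne_zero
  -- the reflection `conj c * z₀ ^ m * z₁ ^ n` of a constant `c` is not constant, as `0 < m`
  have h10 : (2 : ℂ) ^ m = 1 := mul_right_cancel₀ h9 (by rw [← h8, one_mul])
  have h11 : (2 : ℕ) ^ m = 1 := by exact_mod_cast h10
  exact (Nat.one_lt_two_pow hm.ne').ne' h11

/-! ### The polynomial `p̃ - α p` -/

/-- The polynomial `p̃ - α p`, whose zero set on the torus carries the Clark measure. -/
def levelPoly (m n : ℕ) (p : MvPolynomial (Fin 2) ℂ) (α : Circle) : MvPolynomial (Fin 2) ℂ :=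
  reflectPoly m n p - MvPolynomial.C (α : ℂ) * p

theorem eval_levelPoly (m n : ℕ) (p : MvPolynomial (Fin 2) ℂ) (α : Circle) {z : Fin 2 → ℂ}
    (hz : MvPolynomial.eval z p ≠ 0) : MvPolynomial.eval z (levelPoly m n p α) =
      (rif m n p z - α) * MvPolynomial.eval z p := by
  rw [levelPoly, map_sub, map_mul, MvPolynomial.eval_C, sub_mul, rif, div_mul_cancel₀ _ hz]

theorem IsRIFDenominator.rif_ne {m n : ℕ} (hm : 0 < m) {p : MvPolynomial (Fin 2) ℂ}
    (hp : IsRIFDenominator m n p) (α : Circle) {z : Fin 2 → ℂ} (hz : z ∈ bidisk) :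
    rif m n p z ≠ α := fun h => by
  have := hp.norm_rif_lt_one hm hz
  rw [h, Circle.norm_coe] at this
  exact lt_irrefl _ this

theorem IsRIFDenominator.eval_levelPoly_ne_zero {m n : ℕ} (hm : 0 < m)
    {p : MvPolynomial (Fin 2) ℂ} (hp : IsRIFDenominator m n p) (α : Circle) {z : Fin 2 → ℂ}
    (hz : z ∈ bidisk) : MvPolynomial.eval z (levelPoly m n p α) ≠ 0 := by
  rw [eval_levelPoly m n p α (hp.stable z hz)]
  exact mul_ne_zero (sub_ne_zero.2 (hp.rif_ne hm α hz)) (hp.stable z hz)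

/-- For a generic value `α`, the polynomial `p̃ - α p` has no zeros with one coordinate `0` and the
other on the unit circle: such a zero would propagate to a whole disc, on which `φ = α`. -/
theorem IsRIFDenominator.eval_levelPoly_update_ne_zero {m n : ℕ} (hm : 0 < m)
    {p : MvPolynomial (Fin 2) ℂ} (hp : IsRIFDenominator m n p) {α : Circle}
    (hα : IsGenericValue (rif m n p) α) (ζ : Fin 2 → Circle) (j : Fin 2) :
    MvPolynomial.eval (Function.update (fun i => (ζ i : ℂ)) j 0) (levelPoly m n p α) ≠ 0 := by
  intro h0
  have hall : ∀ a : ℂ, ‖a‖ < 1 →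
      rif m n p (Function.update (fun i => (ζ i : ℂ)) j a) = α := by
    intro a ha
    have h1 := norm_eval_update_le (fun z hz => hp.eval_levelPoly_ne_zero hm α hz)
      (fun i => (Circle.norm_coe (ζ i)).le) j a (b := 0) (by simp)
    have hpa : MvPolynomial.eval (Function.update (fun i => (ζ i : ℂ)) j a) p ≠ 0 :=
      hp.eval_update_ne_zero ζ (i := j + 1) (by fin_cases j <;> simp) ha
    rw [h0, norm_zero, mul_zero, norm_le_zero_iff, eval_levelPoly m n p α hpa] at h1
    exact sub_eq_zero.1 ((mul_eq_zero.1 h1).resolve_right hpa)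
  refine hα ⟨ζ (j + 1), ?_⟩
  fin_cases j
  · refine Or.inr fun z hz => ?_
    rw [← hall z hz]
    congr 1
    ext i
    fin_cases i <;> simp
  · refine Or.inl fun z hz => ?_
    rw [← hall z hz]
    congr 1
    ext i
    fin_cases i <;> simp

/-- On the zero set of `p̃ - α p` in the torus, `conj ζⱼ` is an element of the bidisc algebra:
writing `p̃ - α p = q₀ + zⱼ s` with `q₀` independent of `zⱼ`, it is equal to `- s / q₀`. -/
theorem IsRIFDenominator.exists_mem_bidiscAlgebra_eq_conj {m n : ℕ} (hm : 0 < m)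
    {p : MvPolynomial (Fin 2) ℂ} (hp : IsRIFDenominator m n p) {α : Circle}
    (hα : IsGenericValue (rif m n p) α) (j : Fin 2) :
    ∃ a ∈ bidiscAlgebra, ∀ ζ : Fin 2 → Circle,
      MvPolynomial.eval (fun i => (ζ i : ℂ)) (levelPoly m n p α) = 0 → a ζ = conj (ζ j : ℂ) := by
  set q := levelPoly m n p α with hq
  let q₀ : MvPolynomial (Fin 2) ℂ :=
    MvPolynomial.aeval (Function.update MvPolynomial.X j 0 : Fin 2 → MvPolynomial (Fin 2) ℂ) q
  have hev : ∀ z, MvPolynomial.eval z q₀ = MvPolynomial.eval (Function.update z j 0) q := by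
    intro z
    rw [← MvPolynomial.aeval_eq_eval, MvPolynomial.comp_aeval_apply, MvPolynomial.aeval_eq_eval]
    congr 2
    ext i
    rcases eq_or_ne i j with rfl | hi
    · simp
    · simp [Function.update_of_ne hi]
  obtain ⟨s, hs⟩ : MvPolynomial.X j - MvPolynomial.C 0 ∣ q - q₀ := by
    refine MvPolynomial.X_sub_C_dvd_of_forall_eval_update (fun _ => infinite_ball) fun z _ => ?_
    rw [map_sub, hev, Function.update_idem, sub_self]
  obtain ⟨b, hb, hbq⟩ : ∃ a ∈ bidiscAlgebra, a * polyMap q₀ = 1 := by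
    refine exists_mul_polyMap_eq_one fun z hz => ?_
    rw [hev]
    rcases (hz (j + 1)).lt_or_eq with h1 | h1
    · refine hp.eval_levelPoly_ne_zero hm α fun i => ?_
      rcases eq_or_ne i j with rfl | hi
      · simp
      · obtain rfl : i = j + 1 := by fin_cases j <;> fin_cases i <;> simp_all
        rwa [Function.update_of_ne hi]
    · have h2 := hp.eval_levelPoly_update_ne_zero hm hα
        (fun _ => ⟨z (j + 1), mem_sphere_zero_iff_norm.2 h1⟩) j
      convert h2 using 3
      ext i
      rcases eq_or_ne i j with rfl | hi
      · simp
      · obtain rfl : i = j + 1 := by fin_cases j <;> fin_cases i <;> simp_all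
        rw [Function.update_of_ne hi, Function.update_of_ne hi]
  refine ⟨-(b * polyMap s), neg_mem (mul_mem hb (polyMap_mem s)), fun ζ hζ => ?_⟩
  have h1 := congrArg (MvPolynomial.eval fun i => (ζ i : ℂ)) hs
  have h2 := congrArg (fun f => f ζ) hbq
  simp only [map_sub, map_mul, MvPolynomial.eval_X, MvPolynomial.eval_C, hζ, zero_sub,
    sub_zero] at h1
  simp only [ContinuousMap.mul_apply, ContinuousMap.one_apply, polyMap_apply] at h2
  rw [ContinuousMap.neg_apply, ContinuousMap.mul_apply, polyMap_apply]
  have h3 : conj (ζ j : ℂ) * ζ j = 1 := by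
    rw [RCLike.conj_mul, Circle.norm_coe]
    simp
  linear_combination conj (ζ j : ℂ) * h2 + conj (ζ j : ℂ) * b ζ * h1 +
    (b ζ * MvPolynomial.eval (fun i => (ζ i : ℂ)) s) * h3

/-! ### Uniqueness of a measure with given Poisson integral -/

/-- The Poisson kernel of the disc at the point `1 / 2`, as a function on the circle. Any radius in
`(0, 1)` would serve: what matters is that all its Fourier coefficients are nonzero. -/
def poissonHalf (s : Circle) : ℝ := (1 - (1 / 2 : ℝ) ^ 2) / ‖1 - (1 / 2 : ℂ) * s‖ ^ 2

theorem norm_one_sub_half_ne_zero (s : Circle) : ‖1 - (1 / 2 : ℂ) * s‖ ≠ 0 := by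
  rw [norm_ne_zero_iff, sub_ne_zero]
  intro h
  have := congrArg norm h
  rw [norm_mul, Circle.norm_coe] at this
  norm_num at this

theorem continuous_poissonHalf : Continuous poissonHalf := by
  unfold poissonHalf
  refine Continuous.div continuous_const (by fun_prop) fun s => ?_
  exact pow_ne_zero _ (norm_one_sub_half_ne_zero s)

/-- The point `ζ / 2` of the bidisc. -/
def halfPoint (ζ : Fin 2 → Circle) : Fin 2 → ℂ := fun j => (1 / 2 : ℂ) * ζ j

theorem halfPoint_mem (ζ : Fin 2 → Circle) : halfPoint ζ ∈ bidisk := fun j => by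
  rw [halfPoint, norm_mul, Circle.norm_coe]
  norm_num

theorem poissonKernelBidisk_halfPoint (ζ η : Fin 2 → Circle) :
    poissonKernelBidisk (halfPoint ζ) η = ∏ j, poissonHalf (ζ j * (η j)⁻¹) := by
  refine Finset.prod_congr rfl fun j _ => ?_
  have h1 : ‖(1 / 2 : ℂ) * ζ j‖ = 1 / 2 := by
    rw [norm_mul, Circle.norm_coe]
    norm_num
  have h2 : ‖(η j : ℂ) - 1 / 2 * ζ j‖ = ‖1 - (1 / 2 : ℂ) * ((ζ j * (η j)⁻¹ : Circle) : ℂ)‖ := by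
    have : (η j : ℂ) - 1 / 2 * ζ j = η j * (1 - (1 / 2 : ℂ) * ((ζ j * (η j)⁻¹ : Circle) : ℂ)) := by
      have := Circle.coe_ne_zero (η j)
      push_cast
      field_simp
    rw [this, norm_mul, Circle.norm_coe, one_mul]
  rw [poissonHalf, halfPoint, h1, h2]

/-- The Fourier coefficients of the one-variable Poisson kernel. -/
def poissonCoeff (k : ℤ) : ℂ :=
  ∫ s : Circle, ((s ^ k : Circle) : ℂ) * poissonHalf s ∂(Measure.haarMeasure ⊤)

theorem integral_torusChar_mul_poissonHalf (k : Fin 2 → ℤ) :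
    ∫ ζ, torusChar k ζ * ((∏ j, poissonHalf (ζ j) : ℝ) : ℂ) ∂torusHaar =
      ∏ j, poissonCoeff (k j) := by
  unfold poissonCoeff torusHaar
  rw [← integral_fintype_prod_eq_prod]
  refine integral_congr_ae (ae_of_all _ fun ζ => ?_)
  simp only [torusChar_apply, Complex.ofReal_prod, Finset.prod_mul_distrib]

/-- The Poisson kernel is `P_z = |C_z|² / C_z(z)` on the torus. -/
theorem poissonKernel_eq_cauchyTorus (z : bidisk) (ζ : Fin 2 → Circle) :
    (poissonKernelBidisk z ζ : ℂ) * cauchyKernel z z =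
      conj (cauchyTorus z ζ) * cauchyTorus z ζ := by
  rw [cauchyTorus_apply, cauchyKernel, cauchyKernel, poissonKernelBidisk, map_prod,
    Complex.ofReal_prod, ← Finset.prod_mul_distrib, ← Finset.prod_mul_distrib]
  refine Finset.prod_congr rfl fun j _ => ?_
  have h1 : ‖(1 : ℂ) - ζ j * conj (z.1 j)‖ = ‖(ζ j : ℂ) - z.1 j‖ := by
    have : conj ((1 : ℂ) - ζ j * conj (z.1 j)) = conj (ζ j : ℂ) * (ζ j - z.1 j) := by
      rw [map_sub, map_one, map_mul, Complex.conj_conj, mul_sub, RCLike.conj_mul, Circle.norm_coe]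
      simp
    rw [← RCLike.norm_conj, this, norm_mul, RCLike.norm_conj, Circle.norm_coe, one_mul]
  have h2 : (1 : ℂ) - z.1 j * conj (z.1 j) ≠ 0 := one_sub_mul_conj_ne_zero (z.2 j).le (z.2 j)
  rw [RCLike.mul_conj] at h2 ⊢
  have h3 : conj ((1 : ℂ) - ζ j * conj (z.1 j)) * (1 - ζ j * conj (z.1 j)) =
      (‖(ζ j : ℂ) - z.1 j‖ : ℂ) ^ 2 := by
    rw [RCLike.conj_mul, h1]
    rfl
  have h4 : conj ((1 : ℂ) - ζ j * conj (z.1 j)) * (1 - ζ j * conj (z.1 j)) ≠ 0 :=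
    mul_ne_zero ((map_ne_zero _).2 (one_sub_mul_conj_ne_zero (Circle.norm_coe _).le (z.2 j)))
      (one_sub_mul_conj_ne_zero (Circle.norm_coe _).le (z.2 j))
  have h5 : ((((1 - ‖z.1 j‖ ^ 2) / ‖(ζ j : ℂ) - z.1 j‖ ^ 2 : ℝ)) : ℂ) =
      (1 - (‖z.1 j‖ : ℂ) ^ 2) / (‖(ζ j : ℂ) - z.1 j‖ : ℂ) ^ 2 := by push_cast; rfl
  refine (congrArg (· * (1 / (1 - (‖z.1 j‖ : ℂ) ^ 2))) (h5.trans (by rw [← h3]))).trans ?_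
  rw [map_div₀, map_one, div_mul_div_comm, div_mul_div_comm, mul_one, mul_one, mul_comm]
  exact (div_mul_cancel_left₀ h2 _).trans (one_div _).symm

/-- The Poisson integral reproduces the functions in the bidisc algebra. -/
theorem integral_mul_poissonKernel (z : bidisk) {a : C(Fin 2 → Circle, ℂ)}
    (ha : a ∈ bidiscAlgebra) :
    ∫ ζ, a ζ * (poissonKernelBidisk z ζ : ℂ) ∂torusHaar = cauchyEval z a := by
  have h0 : cauchyKernel z z ≠ 0 := cauchyKernel_ne_zero z.2 fun j => (z.2 j).le
  refine mul_right_cancel₀ h0 ?_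
  have h1 : cauchyEval z (cauchyTorus z * a) = cauchyKernel z z * cauchyEval z a := by
    rw [cauchyEval_mul z (cauchyTorus_mem z) ha, cauchyEval_cauchyTorus]
  rw [← integral_mul_const, mul_comm (cauchyEval z a), ← h1, cauchyEval_apply, integralCM_apply]
  refine integral_congr_ae (ae_of_all _ fun ζ => ?_)
  simp only [ContinuousMap.mul_apply, ContinuousMap.star_apply, RCLike.star_def]
  rw [mul_assoc, poissonKernel_eq_cauchyTorus]
  ring

/-- For `a ≥ 0` the square of the coefficient at `a` is a Poisson integral of the monomial
`ζ₀ ^ a * ζ₁ ^ a`, hence `(1 / 2) ^ (2 * a)`; the coefficient at `-a` is its conjugate. -/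
theorem poissonCoeff_ne_zero (k : ℤ) : poissonCoeff k ≠ 0 := by
  have hnat : ∀ a : ℕ, poissonCoeff a ≠ 0 := by
    intro a h
    have h1 := integral_torusChar_mul_poissonHalf (natIndex (a, a))
    have h2 := integral_mul_poissonKernel ⟨halfPoint 1, halfPoint_mem 1⟩
      (torusChar_natIndex_mem (a, a))
    rw [cauchyEval_torusChar] at h2
    have h3 : ∀ ζ : Fin 2 → Circle,
        poissonKernelBidisk (halfPoint 1) ζ = ∏ j, poissonHalf (ζ j) := by
      intro ζ
      rw [poissonKernelBidisk_halfPoint]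
      refine Finset.prod_congr rfl fun j _ => ?_
      simp only [poissonHalf, Pi.one_apply, one_mul]
      congr 2
      rw [← RCLike.norm_conj, Circle.coe_inv_eq_conj]
      simp [map_ofNat]
    simp only [h3] at h2
    rw [h2, Fin.prod_univ_two] at h1
    simp [natIndex, h, halfPoint] at h1
  have hneg : ∀ k : ℤ, poissonCoeff (-k) = conj (poissonCoeff k) := by
    intro k
    rw [poissonCoeff, poissonCoeff, ← integral_conj]
    refine integral_congr_ae (ae_of_all _ fun s => ?_)
    simp only [map_mul, Complex.conj_ofReal, ← Circle.coe_inv_eq_conj, zpow_neg]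
  obtain ⟨a, rfl | rfl⟩ := k.eq_nat_or_neg
  · exact hnat a
  · rw [hneg]
    simpa using hnat a

/-- The Poisson kernel at `ζ / 2` depends only on `ζ / η`, so its integral against a character is a
multiple of the character. -/
theorem integral_torusChar_mul_poissonKernel (k : Fin 2 → ℤ) (η : Fin 2 → Circle) :
    ∫ ζ, torusChar k ζ * (poissonKernelBidisk (halfPoint ζ) η : ℂ) ∂torusHaar =
      (∏ j, poissonCoeff (k j)) * torusChar k η := by
  rw [← integral_mul_left_eq_self _ η, ← integral_torusChar_mul_poissonHalf,
    ← integral_mul_const]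
  refine integral_congr_ae (ae_of_all _ fun ζ => ?_)
  simp only [torusChar_apply_mul, poissonKernelBidisk_halfPoint, Pi.mul_apply, mul_comm (η _),
    mul_inv_cancel_right]
  ring

/-- A finite measure on the torus is determined by its Poisson integral: integrating the Poisson
integral at `ζ / 2` against a character gives a nonzero multiple of a Fourier coefficient. -/
theorem measure_ext_of_integral_poissonKernel {μ ν : Measure (Fin 2 → Circle)} [IsFiniteMeasure μ]
    [IsFiniteMeasure ν] (h : ∀ z ∈ bidisk,
      ∫ ζ, poissonKernelBidisk z ζ ∂μ = ∫ ζ, poissonKernelBidisk z ζ ∂ν) : μ = ν := by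
  have key : ∀ (ρ : Measure (Fin 2 → Circle)) [IsFiniteMeasure ρ] (k : Fin 2 → ℤ),
      (∏ j, poissonCoeff (k j)) * ∫ η, torusChar k η ∂ρ =
        ∫ ζ, torusChar k ζ *
          ((∫ η, poissonKernelBidisk (halfPoint ζ) η ∂ρ : ℝ) : ℂ) ∂torusHaar := by
    intro ρ _ k
    have hcont : Continuous fun x : (Fin 2 → Circle) × (Fin 2 → Circle) =>
        torusChar k x.1 * (poissonKernelBidisk (halfPoint x.1) x.2 : ℂ) := by
      simp only [poissonKernelBidisk_halfPoint]
      have := continuous_poissonHalf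
      have := (torusChar k).continuous
      fun_prop
    have hint : Integrable (Function.uncurry fun ζ η : Fin 2 → Circle =>
        torusChar k ζ * (poissonKernelBidisk (halfPoint ζ) η : ℂ)) (torusHaar.prod ρ) := by
      let F : C((Fin 2 → Circle) × (Fin 2 → Circle), ℂ) := ⟨_, hcont⟩
      exact Integrable.of_bound hcont.aestronglyMeasurable ‖F‖ (ae_of_all _ F.norm_coe_le_norm)
    have h1 := integral_integral_swap hint
    simp only [integral_torusChar_mul_poissonKernel, integral_const_mul] at h1
    rw [← h1]
    simp only [← integral_complex_ofReal]
  refine measure_ext_of_integral_torusChar fun k => ?_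
  have h0 : ∏ j, poissonCoeff (k j) ≠ 0 :=
    Finset.prod_ne_zero_iff.2 fun j _ => poissonCoeff_ne_zero _
  refine mul_left_cancel₀ h0 ?_
  rw [key, key]
  simp only [h _ (halfPoint_mem _)]

/-! ### Existence of the Clark measure -/

/-- Weak compactness: along an ultrafilter, densities of constant positive mass converge weakly. -/
theorem exists_measure_tendsto_integral {ι : Type*} (l : Ultrafilter ι)
    (u : ι → C(Fin 2 → Circle, ℝ)) (hu : ∀ i ζ, 0 ≤ u i ζ) {c : ℝ} (hc : 0 < c)
    (hmass : ∀ i, ∫ ζ, u i ζ ∂torusHaar = c) :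
    ∃ σ : Measure (Fin 2 → Circle), IsFiniteMeasure σ ∧ ∀ f : C(Fin 2 → Circle, ℂ),
      Tendsto (fun i => ∫ ζ, f ζ * (u i ζ : ℂ) ∂torusHaar) l (𝓝 (∫ ζ, f ζ ∂σ)) := by
  have hint : ∀ i, Integrable (fun ζ => u i ζ) torusHaar := fun i =>
    Integrable.of_bound (u i).continuous.aestronglyMeasurable ‖u i‖
      (ae_of_all _ (u i).norm_coe_le_norm)
  let ν : ι → Measure (Fin 2 → Circle) := fun i =>
    torusHaar.withDensity fun ζ => ENNReal.ofReal (u i ζ / c)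
  have hmeas : ∀ i, Measurable fun ζ => ENNReal.ofReal (u i ζ / c) := fun i =>
    ((u i).continuous.measurable.div_const c).ennreal_ofReal
  have hν : ∀ i, IsProbabilityMeasure (ν i) := fun i => ⟨by
    rw [withDensity_apply _ MeasurableSet.univ, setLIntegral_univ,
      ← ofReal_integral_eq_lintegral_ofReal ((hint i).div_const c)
        (ae_of_all _ fun ζ => div_nonneg (hu i ζ) hc.le), integral_div, hmass, div_self hc.ne',
      ENNReal.ofReal_one]⟩
  let P : ι → ProbabilityMeasure (Fin 2 → Circle) := fun i => ⟨ν i, hν i⟩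
  obtain ⟨ρ, -, hρ⟩ := isCompact_univ.ultrafilter_le_nhds (l.map P) (by simp)
  have hρ' : Tendsto P l (𝓝 ρ) := hρ
  refine ⟨ENNReal.ofReal c • (ρ : Measure (Fin 2 → Circle)),
    Measure.smul_finite _ ENNReal.ofReal_ne_top, fun f => ?_⟩
  have h1 := (ProbabilityMeasure.tendsto_iff_forall_integral_rclike_tendsto ℂ).1 hρ'
    (BoundedContinuousFunction.mkOfCompact f)
  rw [integral_smul_measure, ENNReal.toReal_ofReal hc.le]
  refine (h1.const_smul c).congr fun i => ?_
  change c • ∫ ζ, f ζ ∂(ν i) = _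
  rw [integral_withDensity_eq_integral_toReal_smul (hmeas i) (ae_of_all _ fun _ =>
    ENNReal.ofReal_lt_top), ← integral_smul]
  refine integral_congr_ae (ae_of_all _ fun ζ => ?_)
  simp only
  rw [ENNReal.toReal_ofReal (div_nonneg (hu i ζ) hc.le), smul_smul, mul_div_cancel₀ _ hc.ne',
    Complex.real_smul, mul_comm]

/-- The Herglotz transform `(α + φ) / (α - φ)`. -/
def herglotz (φ : (Fin 2 → ℂ) → ℂ) (α : Circle) (z : Fin 2 → ℂ) : ℂ := (α + φ z) / (α - φ z)

theorem herglotz_re (φ : (Fin 2 → ℂ) → ℂ) (α : Circle) (z : Fin 2 → ℂ) :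
    (herglotz φ α z).re = (1 - ‖φ z‖ ^ 2) / ‖(α : ℂ) - φ z‖ ^ 2 := by
  have h1 : (α : ℂ).re ^ 2 + (α : ℂ).im ^ 2 = 1 := by
    have := Circle.normSq_coe α
    rw [Complex.normSq_apply] at this
    linarith
  rw [herglotz, Complex.div_re, ← Complex.normSq_eq_norm_sq, ← Complex.normSq_eq_norm_sq,
    ← add_div]
  congr 1
  simp only [Complex.normSq_apply, Complex.add_re, Complex.sub_re, Complex.add_im, Complex.sub_im]
  linear_combination h1

/-- The polarization of `Re h = (1 - |φ|²) / |α - φ|²`, with denominators cleared. -/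
theorem herglotz_add_conj {φ : (Fin 2 → ℂ) → ℂ} {α : Circle} {z w : Fin 2 → ℂ} (hz : φ z ≠ α)
    (hw : φ w ≠ α) : (1 - conj (α : ℂ) * φ z) * (1 - α * conj (φ w)) *
      ((herglotz φ α z + conj (herglotz φ α w)) / 2) = 1 - conj (φ w) * φ z := by
  have hα : conj (α : ℂ) * α = 1 := by simp [Complex.conj_mul', Circle.norm_coe]
  have h1 : (α : ℂ) - φ z ≠ 0 := sub_ne_zero.2 hz.symm
  have h2 : conj (α : ℂ) - conj (φ w) ≠ 0 := by
    rw [← map_sub]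
    exact (map_ne_zero _).2 (sub_ne_zero.2 hw.symm)
  have h3 : (1 : ℂ) - conj (α : ℂ) * φ z = conj (α : ℂ) * (α - φ z) := by
    linear_combination -hα
  have h4 : (1 : ℂ) - α * conj (φ w) = α * (conj (α : ℂ) - conj (φ w)) := by
    linear_combination -hα
  rw [herglotz, herglotz, map_div₀, map_add, map_sub, h3, h4]
  field_simp
  linear_combination (2 * conj (α : ℂ) * α - 2 * φ z * conj (φ w) + 2) * hα

/-- A weak limit of the densities `Re h(r ζ)` as `r → 1`, where `h = (α + φ) / (α - φ)`, satisfies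
the polarized Clark identity, and is carried by the zeros of `p̃ - α p`. -/
theorem IsRIFDenominator.exists_clarkMeasure {m n : ℕ} (hm : 0 < m)
    {p : MvPolynomial (Fin 2) ℂ} (hp : IsRIFDenominator m n p) (α : Circle) :
    ∃ (σ : Measure (Fin 2 → Circle)) (_ : IsFiniteMeasure σ),
      (∀ z w : bidisk, integralCM σ (star (cauchyTorus z) * cauchyTorus w) =
        cauchyKernel w z * ((herglotz (rif m n p) α z + conj (herglotz (rif m n p) α w)) / 2)) ∧
      ∀ᵐ ζ ∂σ, MvPolynomial.eval (fun j => (ζ j : ℂ)) (levelPoly m n p α) = 0 := by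
  set q := levelPoly m n p α with hq
  have hq0 : ∀ z ∈ bidisk, MvPolynomial.eval z q ≠ 0 := fun z hz =>
    hp.eval_levelPoly_ne_zero hm α hz
  let H := herglotz (rif m n p) α
  have hH : ∀ z ∈ bidisk, H z * MvPolynomial.eval z q =
      -(α * MvPolynomial.eval z p + MvPolynomial.eval z (reflectPoly m n p)) := by
    intro z hz
    have h1 := hp.stable z hz
    have h2 : (α : ℂ) - rif m n p z ≠ 0 := sub_ne_zero.2 (hp.rif_ne hm α hz).symm
    have h3 : MvPolynomial.eval z (reflectPoly m n p) = rif m n p z * MvPolynomial.eval z p := by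
      rw [rif, div_mul_cancel₀ _ h1]
    rw [eval_levelPoly m n p α h1, h3]
    simp only [H, herglotz]
    field_simp
    ring
  -- radii in `[0, 1)` that tend to `1`
  let r : ℕ → ℝ := fun k => k / (k + 1)
  have hr0 : ∀ k, 0 ≤ r k := fun k => by positivity
  have hr1 : ∀ k, r k < 1 := fun k => by
    rw [div_lt_one (by positivity)]
    linarith
  have hrlim : Tendsto r atTop (𝓝 1) := tendsto_natCast_div_add_atTop 1
  have hmem : ∀ k {z : Fin 2 → ℂ}, (∀ j, ‖z j‖ ≤ 1) → (fun j => r k * z j) ∈ bidisk := fun k _ hz =>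
    mul_mem_bidisk (hr0 k) (hr1 k) hz
  choose b hb hbq using fun k => exists_mul_dilatePoly_eq_one hq0 (hr0 k) (hr1 k)
  -- the dilates of the Herglotz transform belong to the bidisc algebra
  let h : ℕ → C(Fin 2 → Circle, ℂ) := fun k =>
    polyMap (dilatePoly (r k) (-(MvPolynomial.C (α : ℂ) * p + reflectPoly m n p))) * b k
  have hhA : ∀ k, h k ∈ bidiscAlgebra := fun k => mul_mem (polyMap_mem _) (hb k)
  have hhζ : ∀ k (ζ : Fin 2 → Circle), h k ζ = H fun j => r k * ζ j := by
    intro k ζ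
    have h1 := congrArg (fun f => f ζ) (hbq k)
    simp only [ContinuousMap.mul_apply, ContinuousMap.one_apply, polyMap_apply,
      eval_dilatePoly] at h1
    have h2 := hH _ (hmem k fun j => (Circle.norm_coe (ζ j)).le)
    simp only [h, ContinuousMap.mul_apply, polyMap_apply, eval_dilatePoly, map_neg, map_add,
      map_mul, MvPolynomial.eval_C]
    linear_combination (-b k ζ) * h2 + H (fun j => r k * ζ j) * h1
  have hhz : ∀ k (z : bidisk), cauchyEval z (h k) = H fun j => r k * z.1 j := by
    intro k z
    have h1 := congrArg (cauchyEval z) (hbq k)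
    rw [cauchyEval_mul z (hb k) (polyMap_mem _), cauchyEval_polyMap, eval_dilatePoly,
      ← map_one polyMap, cauchyEval_polyMap, map_one] at h1
    have h2 := hH _ (hmem k fun j => (z.2 j).le)
    simp only [h]
    rw [cauchyEval_mul z (polyMap_mem _) (hb k), cauchyEval_polyMap, eval_dilatePoly, map_neg,
      map_add, map_mul, MvPolynomial.eval_C]
    linear_combination (-cauchyEval z (b k)) * h2 + H (fun j => r k * z.1 j) * h1
  let u : ℕ → C(Fin 2 → Circle, ℝ) := fun k =>
    ⟨fun ζ => (h k ζ).re, Complex.continuous_re.comp (h k).continuous⟩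
  have huζ : ∀ k ζ, u k ζ = (H fun j => r k * ζ j).re := fun k ζ => by
    simp only [u, ContinuousMap.coe_mk, hhζ]
  have hHre : ∀ z ∈ bidisk, 0 < (H z).re := by
    intro z hz
    simp only [H]
    rw [herglotz_re]
    have h1 := hp.norm_rif_lt_one hm hz
    refine div_pos (by nlinarith [norm_nonneg (rif m n p z)]) ?_
    exact pow_pos (norm_pos_iff.2 (sub_ne_zero.2 (hp.rif_ne hm α hz).symm)) 2
  have hu0 : ∀ k ζ, 0 ≤ u k ζ := fun k ζ => by
    rw [huζ]
    exact (hHre _ (hmem k fun j => (Circle.norm_coe (ζ j)).le)).le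
  have hgram : ∀ k (z w : bidisk),
      ∫ ζ, (star (cauchyTorus z) * cauchyTorus w) ζ * (u k ζ : ℂ) ∂torusHaar =
        cauchyKernel w z * ((H (fun j => r k * z.1 j) + conj (H fun j => r k * w.1 j)) / 2) := by
    intro k z w
    have h1 : cauchyEval z (cauchyTorus w * h k) = cauchyKernel w z * H fun j => r k * z.1 j := by
      rw [cauchyEval_mul z (cauchyTorus_mem w) (hhA k), cauchyEval_cauchyTorus, hhz]
    have h2 : cauchyEval w (cauchyTorus z * h k) = cauchyKernel z w * H fun j => r k * w.1 j := by
      rw [cauchyEval_mul w (cauchyTorus_mem z) (hhA k), cauchyEval_cauchyTorus, hhz]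
    -- `Re h = (h + conj h) / 2`: both `C_w h` and `C_z h` are reproduced by the Cauchy kernel
    have h3 : conj (cauchyEval w (cauchyTorus z * h k)) =
        integralCM torusHaar (star (star (cauchyTorus w) * (cauchyTorus z * h k))) := by
      rw [cauchyEval_apply, integralCM_apply, integralCM_apply, ← integral_conj]
      rfl
    rw [mul_div_assoc', mul_add, ← h1, ← conj_cauchyKernel z w, ← map_mul, ← h2, h3,
      cauchyEval_apply, ← map_add, integralCM_apply, ← integral_div]
    refine integral_congr_ae (ae_of_all _ fun ζ => ?_)
    simp only [u, ContinuousMap.coe_mk, ContinuousMap.mul_apply, ContinuousMap.add_apply,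
      ContinuousMap.star_apply, RCLike.star_def, map_mul, Complex.conj_conj,
      Complex.re_eq_add_conj]
    ring
  -- at `z = w = 0` the identity gives the total mass
  have hmass : ∀ k, ∫ ζ, u k ζ ∂torusHaar = (H 0).re := by
    intro k
    have h0 : (0 : Fin 2 → ℂ) ∈ bidisk := fun j => by simp
    have h1 := hgram k ⟨0, h0⟩ ⟨0, h0⟩
    have h2 : ∀ z, cauchyKernel 0 z = 1 := fun z => by simp [cauchyKernel]
    have h3 : (fun j => (r k : ℂ) * (0 : Fin 2 → ℂ) j) = 0 := by
      ext j
      simp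
    simp only [ContinuousMap.mul_apply, ContinuousMap.star_apply, cauchyTorus_apply, h2, star_one,
      one_mul, h3, integral_complex_ofReal, ← Complex.re_eq_add_conj] at h1
    exact_mod_cast h1
  obtain ⟨σ, hσ, hlim⟩ := exists_measure_tendsto_integral (hyperfilter ℕ) u hu0
    (hHre 0 fun j => by simp) hmass
  have hle : ((hyperfilter ℕ : Ultrafilter ℕ) : Filter ℕ) ≤ atTop := Nat.hyperfilter_le_atTop
  refine ⟨σ, hσ, fun z w => ?_, ?_⟩
  · refine tendsto_nhds_unique (hlim _) ?_
    simp only [hgram]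
    have hHlim : ∀ z : bidisk, Tendsto (fun k => H fun j => r k * z.1 j) (hyperfilter ℕ)
        (𝓝 (H z)) := by
      intro z
      have hev : ∀ P : MvPolynomial (Fin 2) ℂ,
          Tendsto (fun k => MvPolynomial.eval (fun j => (r k : ℂ) * z.1 j) P) (hyperfilter ℕ)
            (𝓝 (MvPolynomial.eval z.1 P)) := fun P =>
        (tendsto_eval_dilate P z.1).comp (tendsto_nhdsWithin_iff.2
          ⟨hrlim.mono_left hle, Eventually.of_forall hr1⟩)
      have hφ : Tendsto (fun k => rif m n p fun j => (r k : ℂ) * z.1 j) (hyperfilter ℕ)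
          (𝓝 (rif m n p z)) := (hev _).div (hev _) (hp.stable _ z.2)
      exact (hφ.const_add _).div (hφ.const_sub _) (sub_ne_zero.2 (hp.rif_ne hm α z.2).symm)
    have hconj : Tendsto (fun k => conj (H fun j => r k * w.1 j)) (hyperfilter ℕ)
        (𝓝 (conj (H w))) := (Complex.continuous_conj.tendsto _).comp (hHlim w)
    exact (((hHlim z).add hconj).div_const 2).const_mul _
  · -- `|q|² u` is dominated by `|p(r ζ)|² - |p̃(r ζ)|²`, which tends to `0` on the torus
    let g : ℝ → (Fin 2 → Circle) → ℝ := fun t ζ =>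
      ‖MvPolynomial.eval (fun j => (t : ℂ) * ζ j) p‖ ^ 2 -
        ‖MvPolynomial.eval (fun j => (t : ℂ) * ζ j) (reflectPoly m n p)‖ ^ 2
    have hg : Continuous g.uncurry := by
      have hev : ∀ P : MvPolynomial (Fin 2) ℂ, Continuous fun x : ℝ × (Fin 2 → Circle) =>
          MvPolynomial.eval (fun j => (x.1 : ℂ) * x.2 j) P := fun P =>
        P.continuous_eval.comp (by fun_prop)
      exact ((hev _).norm.pow 2).sub ((hev _).norm.pow 2)
    have hg1 : ∀ ζ, g 1 ζ = 0 := fun ζ => by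
      simp only [g, Complex.ofReal_one, one_mul, hp.norm_eval_reflectPoly_torus, sub_self]
    have hglim : Tendsto (fun k => (2 ^ q.totalDegree) ^ 2 * ∫ ζ, g (r k) ζ ∂torusHaar)
        (hyperfilter ℕ) (𝓝 0) := by
      have h1 := continuous_parametric_integral_of_continuous (μ := torusHaar) hg isCompact_univ
      have h2 := ((h1.tendsto 1).comp (hrlim.mono_left hle)).const_mul ((2 ^ q.totalDegree) ^ 2 : ℝ)
      simp only [Measure.restrict_univ, hg1, integral_zero, mul_zero] at h2
      exact h2
    let Q : C(Fin 2 → Circle, ℂ) := star (polyMap q) * polyMap q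
    have hQ : ∀ ζ, Q ζ = ((‖MvPolynomial.eval (fun j => (ζ j : ℂ)) q‖ ^ 2 : ℝ) : ℂ) := fun ζ => by
      simp only [Q, ContinuousMap.mul_apply, ContinuousMap.star_apply, RCLike.star_def,
        polyMap_apply, Complex.conj_mul', Complex.ofReal_pow]
    have hbound : ∀ k ζ, ‖MvPolynomial.eval (fun j => (ζ j : ℂ)) q‖ ^ 2 * u k ζ ≤
        (2 ^ q.totalDegree) ^ 2 * g (r k) ζ := by
      intro k ζ
      have hz := hmem k fun j => (Circle.norm_coe (ζ j)).le
      set z : Fin 2 → ℂ := fun j => r k * ζ j with hzdef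
      have h1 := norm_eval_le_radial hq0 (fun j => (Circle.norm_coe (ζ j)).le) (hr0 k) (hr1 k)
      rw [← hzdef] at h1
      have h2 : u k ζ * ‖MvPolynomial.eval z q‖ ^ 2 = g (r k) ζ := by
        have h3 : MvPolynomial.eval z p ≠ 0 := hp.stable z hz
        have h4 : ‖rif m n p z - α‖ ≠ 0 :=
          norm_ne_zero_iff.2 (sub_ne_zero.2 (hp.rif_ne hm α hz))
        have h5 : ‖MvPolynomial.eval z (reflectPoly m n p)‖ =
            ‖rif m n p z‖ * ‖MvPolynomial.eval z p‖ := by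
          rw [← norm_mul, rif, div_mul_cancel₀ _ h3]
        rw [huζ]
        simp only [H, g]
        rw [← hzdef, herglotz_re, eval_levelPoly m n p α h3, norm_mul, norm_sub_rev, h5]
        field_simp
      calc _ ≤ (2 ^ q.totalDegree * ‖MvPolynomial.eval z q‖) ^ 2 * u k ζ := by
            gcongr
            exact hu0 k ζ
        _ = _ := by rw [← h2]; ring
    have hintg : ∀ t, Integrable (g t) torusHaar := fun t => by
      have hc : Continuous fun ζ => g.uncurry (t, ζ) := hg.comp (by fun_prop)
      let F : C(Fin 2 → Circle, ℝ) := ⟨_, hc⟩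
      exact Integrable.of_bound hc.aestronglyMeasurable ‖F‖ (ae_of_all _ F.norm_coe_le_norm)
    have hQlim := hlim Q
    simp only [hQ, ← Complex.ofReal_mul, integral_complex_ofReal] at hQlim
    have hQlim' : Tendsto
        (fun k => ∫ ζ, ‖MvPolynomial.eval (fun j => (ζ j : ℂ)) q‖ ^ 2 * u k ζ ∂torusHaar)
        (hyperfilter ℕ) (𝓝 (∫ ζ, ‖MvPolynomial.eval (fun j => (ζ j : ℂ)) q‖ ^ 2 ∂σ)) := by
      have h1 := (Complex.continuous_re.tendsto _).comp hQlim
      simpa only [Function.comp_def, Complex.ofReal_re] using h1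
    have hzero : ∫ ζ, ‖MvPolynomial.eval (fun j => (ζ j : ℂ)) q‖ ^ 2 ∂σ = 0 := by
      have h1 : Tendsto
          (fun k => ∫ ζ, ‖MvPolynomial.eval (fun j => (ζ j : ℂ)) q‖ ^ 2 * u k ζ ∂torusHaar)
          (hyperfilter ℕ) (𝓝 0) := by
        refine squeeze_zero (fun k => ?_) (fun k => ?_) hglim
        · exact integral_nonneg fun ζ => mul_nonneg (by positivity) (hu0 k ζ)
        · rw [← integral_const_mul]
          exact integral_mono_of_nonneg
            (ae_of_all _ fun ζ => mul_nonneg (by positivity) (hu0 k ζ))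
            ((hintg (r k)).const_mul _) (ae_of_all _ (hbound k))
      exact tendsto_nhds_unique hQlim' h1
    have hint : Integrable (fun ζ : Fin 2 → Circle =>
        ‖MvPolynomial.eval (fun j => (ζ j : ℂ)) q‖ ^ 2) σ := by
      have := (integrable_continuousMap σ Q).re
      simpa only [hQ, RCLike.re_to_complex, Complex.ofReal_re] using this
    have h0 := (integral_eq_zero_iff_of_nonneg (fun ζ => by positivity) hint).1 hzero
    filter_upwards [h0] with ζ hζ
    exact norm_eq_zero.1 (pow_eq_zero_iff two_ne_zero |>.1 hζ)

/-- The Clark measure is unique, satisfies the polarized form of its defining identity, and is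
carried by the zero set of `p̃ - α p`. -/
theorem IsRIFDenominator.exists_isClarkMeasure {m n : ℕ} (hm : 0 < m)
    {p : MvPolynomial (Fin 2) ℂ} (hp : IsRIFDenominator m n p) (α : Circle) :
    ∃ (σ : Measure (Fin 2 → Circle)) (_ : IsFiniteMeasure σ), IsClarkMeasure (rif m n p) α σ ∧
      (∀ τ, IsClarkMeasure (rif m n p) α τ → τ = σ) ∧
      (∀ z w : bidisk, integralCM σ (star (cauchyTorus z) * cauchyTorus w) =
        cauchyKernel w z * ((herglotz (rif m n p) α z + conj (herglotz (rif m n p) α w)) / 2)) ∧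
      ∀ᵐ ζ ∂σ, MvPolynomial.eval (fun j => (ζ j : ℂ)) (levelPoly m n p α) = 0 := by
  obtain ⟨σ, hσ, hgram, hae⟩ := hp.exists_clarkMeasure hm α
  have hclark : IsClarkMeasure (rif m n p) α σ := by
    refine ⟨hσ, fun z hz => ?_⟩
    have h1 := hgram ⟨z, hz⟩ ⟨z, hz⟩
    rw [← Complex.re_eq_add_conj, herglotz_re, integralCM_apply] at h1
    simp only [ContinuousMap.mul_apply, ContinuousMap.star_apply, RCLike.star_def,
      ← poissonKernel_eq_cauchyTorus, integral_mul_const, integral_complex_ofReal] at h1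
    rw [mul_comm] at h1
    have h2 := mul_left_cancel₀ (cauchyKernel_ne_zero hz fun j => (hz j).le) h1
    exact_mod_cast h2.symm
  refine ⟨σ, hσ, hclark, fun τ hτ => ?_, hgram, hae⟩
  have := hτ.isFiniteMeasure
  exact measure_ext_of_integral_poissonKernel fun z hz => by
    rw [← hτ.poisson_eq z hz, ← hclark.poisson_eq z hz]

/-! ### The Clark embedding -/

/-- Two families of vectors with the same Gram matrix and dense spans are related by a unitary. -/
theorem exists_linearIsometryEquiv_of_inner_eq {ι H₁ H₂ : Type*} [NormedAddCommGroup H₁]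
    [InnerProductSpace ℂ H₁] [CompleteSpace H₁] [NormedAddCommGroup H₂] [InnerProductSpace ℂ H₂]
    [CompleteSpace H₂] {k : ι → H₁} {t : ι → H₂}
    (hk : (Submodule.span ℂ (Set.range k)).topologicalClosure = ⊤)
    (ht : (Submodule.span ℂ (Set.range t)).topologicalClosure = ⊤)
    (h : ∀ i j, ⟪k i, k j⟫_ℂ = ⟪t i, t j⟫_ℂ) : ∃ U : H₁ ≃ₗᵢ[ℂ] H₂, ∀ i, U (k i) = t i := by
  let S := Finsupp.linearCombination ℂ k
  let T := Finsupp.linearCombination ℂ t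
  have hnorm : ∀ x, ‖T x‖ = ‖S x‖ := by
    intro x
    rw [@norm_eq_sqrt_re_inner ℂ, @norm_eq_sqrt_re_inner ℂ]
    simp only [S, T, Finsupp.linearCombination_apply, Finsupp.sum_inner, Finsupp.inner_sum,
      inner_smul_left, inner_smul_right, h]
  have hdense : DenseRange S := by
    have h1 : Dense (LinearMap.range S : Set H₁) := by
      rw [Submodule.dense_iff_topologicalClosure_eq_top, Finsupp.range_linearCombination, hk]
    exact h1
  let V := T.extendOfNorm S
  have hV : ∀ x, V (S x) = T x := fun x =>
    LinearMap.extendOfNorm_eq hdense ⟨1, fun x => by rw [one_mul, hnorm]⟩ x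
  have hVn : ∀ x, ‖V x‖ = ‖x‖ := fun x =>
    hdense.induction_on (p := fun x => ‖V x‖ = ‖x‖) x
      (isClosed_eq (by fun_prop) (by fun_prop)) fun a => by rw [hV, hnorm]
  let W : H₁ →ₗᵢ[ℂ] H₂ := ⟨V.toLinearMap, hVn⟩
  have hWk : ∀ i, W (k i) = t i := fun i => by
    have h1 : V (k i) = t i := by simpa [S, T] using hV (Finsupp.single i 1)
    exact h1
  have hsurj : Function.Surjective W := by
    have hle : (⊤ : Submodule ℂ H₂) ≤ LinearMap.range W.toLinearMap := by
      rw [← ht]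
      refine Submodule.topologicalClosure_minimal _ (Submodule.span_le.2 ?_)
        W.isometry.isClosedEmbedding.isClosed_range
      rintro - ⟨i, rfl⟩
      exact ⟨k i, hWk i⟩
    intro y
    obtain ⟨x, hx⟩ := hle (Submodule.mem_top (x := y))
    exact ⟨x, hx⟩
  exact ⟨LinearIsometryEquiv.ofSurjective W hsurj, hWk⟩

/-- If both functions `conj ζⱼ` agree `σ`-almost everywhere with elements of the bidisc algebra,
then the Cauchy kernels span a dense subspace of `L²(σ)`. -/
theorem eq_top_of_cauchyTorus_mem {σ : Measure (Fin 2 → Circle)} [IsFiniteMeasure σ]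
    (hσ : ∀ j, ∃ a ∈ bidiscAlgebra, ∀ᵐ ζ ∂σ, a ζ = conj (ζ j : ℂ))
    {S : Submodule ℂ (Lp ℂ 2 σ)} (hS : IsClosed (S : Set (Lp ℂ 2 σ)))
    (h : ∀ w, torusToL2 σ (cauchyTorus w) ∈ S) : S = ⊤ := by
  have hA : ∀ a ∈ bidiscAlgebra, torusToL2 σ a ∈ S := fun a ha =>
    bidiscAlgebra_le_of_cauchyTorus_mem (S := S.comap (torusToL2 σ).toLinearMap)
      (hS.preimage (torusToL2 σ).continuous) h ha
  have hpow : ∀ j (k : ℤ), ∃ a ∈ bidiscAlgebra, ∀ᵐ ζ ∂σ, a ζ = ((ζ j ^ k : Circle) : ℂ) := by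
    intro j k
    obtain ⟨l, rfl | rfl⟩ := k.eq_nat_or_neg
    · refine ⟨polyMap (MvPolynomial.X j ^ l), polyMap_mem _, ae_of_all _ fun ζ => ?_⟩
      simp [polyMap_apply]
    · obtain ⟨a, ha, hae⟩ := hσ j
      refine ⟨a ^ l, pow_mem ha l, ?_⟩
      filter_upwards [hae] with ζ hζ
      rw [ContinuousMap.pow_apply, hζ, zpow_neg, ← inv_zpow, zpow_natCast, Circle.coe_pow,
        Circle.coe_inv_eq_conj]
  have hchar : ∀ k, torusToL2 σ (torusChar k) ∈ S := by
    intro k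
    choose a ha hae using fun j => hpow j (k j)
    convert hA (a 0 * a 1) (mul_mem (ha 0) (ha 1)) using 1
    refine Lp.ext ?_
    filter_upwards [ContinuousMap.coeFn_toLp (p := 2) (𝕜 := ℂ) σ (torusChar k),
      ContinuousMap.coeFn_toLp (p := 2) (𝕜 := ℂ) σ (a 0 * a 1), hae 0, hae 1] with ζ h1 h2 h3 h4
    rw [h1, h2, torusChar_apply, Fin.prod_univ_two, ContinuousMap.mul_apply, h3, h4]
  have hall : ∀ f, torusToL2 σ f ∈ S := fun f =>
    mem_of_forall_torusChar_mem (S := S.comap (torusToL2 σ).toLinearMap)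
      (hS.preimage (torusToL2 σ).continuous) hchar f
  have hdense := ContinuousMap.toLp_denseRange ℂ σ ℂ (p := 2) (by norm_num)
  refine eq_top_iff.2 fun x _ => ?_
  exact closure_minimal (Set.range_subset_iff.2 hall) hS (hdense x)

/-- A function in the model space that is orthogonal to the reproducing kernels vanishes in the
bidisc. -/
theorem span_modelKernel_topologicalClosure {φ : (Fin 2 → ℂ) → ℂ} {K : bidisk → modelSpace φ}
    (hK : ∀ w f, ⟪K w, f⟫_ℂ = hardyEval f w) :
    (Submodule.span ℂ (Set.range K)).topologicalClosure = ⊤ := by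
  have : CompleteSpace (modelSpace φ) := by unfold modelSpace; infer_instance
  rw [Submodule.topologicalClosure_eq_top_iff, Submodule.eq_bot_iff]
  intro f hf
  refine Subtype.ext (eq_of_hardyEval_eq fun z hz => ?_)
  have h1 := (Submodule.mem_orthogonal _ _).1 hf (K ⟨z, hz⟩) (Submodule.subset_span ⟨_, rfl⟩)
  rw [hK] at h1
  rw [h1]
  simp [hardyEval]

theorem mainTheorem5 (m n : ℕ) (hm : 0 < m) (hn : 0 < n) (p : MvPolynomial (Fin 2) ℂ)
    (hp : IsRIFDenominator m n p) (α : Circle) (hα : IsGenericValue (rif m n p) α) :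
    (∃! σ : Measure (Fin 2 → Circle), IsClarkMeasure (rif m n p) α σ) ∧
    ∀ σ : Measure (Fin 2 → Circle), IsClarkMeasure (rif m n p) α σ →
      ∃ J : modelSpace (rif m n p) ≃ₗᵢ[ℂ] Lp ℂ 2 σ,
        IsClarkEmbedding (rif m n p) α σ (J : modelSpace (rif m n p) →L[ℂ] Lp ℂ 2 σ) ∧
        ∀ T : modelSpace (rif m n p) →L[ℂ] Lp ℂ 2 σ,
          IsClarkEmbedding (rif m n p) α σ T →
            T = (J : modelSpace (rif m n p) →L[ℂ] Lp ℂ 2 σ) := by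
  obtain ⟨σ, hfin, hσ, huniq, hgram, hae⟩ := hp.exists_isClarkMeasure hm α
  refine ⟨⟨σ, hσ, huniq⟩, fun τ hτ => ?_⟩
  obtain rfl := huniq τ hτ
  obtain ⟨K, hK, hKf⟩ := hp.exists_modelKernel
  have : CompleteSpace (modelSpace (rif m n p)) := by unfold modelSpace; infer_instance
  let t : bidisk → Lp ℂ 2 τ := fun w =>
    torusToL2 τ ((1 - (α : ℂ) * conj (rif m n p w)) • cauchyTorus w)
  have hne : ∀ w : bidisk, 1 - (α : ℂ) * conj (rif m n p w) ≠ 0 := fun w =>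
    one_sub_mul_conj_ne_zero (Circle.norm_coe α).le (hp.norm_rif_lt_one hm w.2)
  have hinner : ∀ z w, ⟪K z, K w⟫_ℂ = ⟪t z, t w⟫_ℂ := by
    intro z w
    have h1 := herglotz_add_conj (hp.rif_ne hm α z.2) (hp.rif_ne hm α w.2)
    rw [hKf, hK w z z.2, ← h1]
    simp only [t, map_smul, inner_smul_left, inner_smul_right]
    rw [inner_torusToL2, hgram, map_sub, map_one, map_mul, Complex.conj_conj]
    ring
  have hdense : (Submodule.span ℂ (Set.range t)).topologicalClosure = ⊤ := by
    refine eq_top_of_cauchyTorus_mem (fun j => ?_) (Submodule.isClosed_topologicalClosure _)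
      fun w => ?_
    · obtain ⟨a, ha, h⟩ := hp.exists_mem_bidiscAlgebra_eq_conj hm hα j
      exact ⟨a, ha, hae.mono h⟩
    · have h1 : t w ∈ (Submodule.span ℂ (Set.range t)).topologicalClosure :=
        Submodule.le_topologicalClosure _ (Submodule.subset_span ⟨w, rfl⟩)
      have h2 := Submodule.smul_mem _ (1 - (α : ℂ) * conj (rif m n p w))⁻¹ h1
      simp only [t, map_smul, smul_smul] at h2
      rwa [inv_mul_cancel₀ (hne w), one_smul] at h2
  have hKdense := span_modelKernel_topologicalClosure hKf
  obtain ⟨J, hJ⟩ := exists_linearIsometryEquiv_of_inner_eq hKdense hdense hinner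
  have ht : ∀ w : bidisk, (t w : (Fin 2 → Circle) → ℂ) =ᵐ[τ]
      fun ζ => (1 - (α : ℂ) * conj (rif m n p w)) * cauchyKernel w (fun j => (ζ j : ℂ)) := fun w =>
    ContinuousMap.coeFn_toLp (p := 2) (𝕜 := ℂ) τ _
  refine ⟨J, fun w hw => ⟨K ⟨w, hw⟩, fun z hz => hK ⟨w, hw⟩ z hz, ?_⟩, fun T hT => ?_⟩
  · change (J (K ⟨w, hw⟩) : (Fin 2 → Circle) → ℂ) =ᵐ[τ] _
    rw [hJ]
    exact ht ⟨w, hw⟩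
  · refine ContinuousLinearMap.ext_on
      (Submodule.dense_iff_topologicalClosure_eq_top.2 hKdense) ?_
    rintro - ⟨w, rfl⟩
    obtain ⟨k, hk, hTk⟩ := hT w w.2
    obtain rfl : k = K w := Subtype.ext (eq_of_hardyEval_eq fun z hz => by
      rw [hk z hz, hK w z hz])
    change T (K w) = J (K w)
    rw [hJ]
    exact Lp.ext (hTk.trans (ht w).symm)

end
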